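/- Let $H$ be a separable complex Hilbert space and let $A$, $B$ be (possibly unbounded) linear operators in $H$ such that $A$ is skew-adjoint with (dense) domain $D(A)$, $\mathrm{i}A$ is bounded from below, $B$ is skew-symmetric, $D(A)\subset D(B)$, and, for some $a>0$, $\|B\psi\|\le a\|A\psi\|$ for every $\psi\in D(A)$. Let $\delta\in(0,1)$, let $T\in\mathbf{R}$, and let $\mathcal{U}_{\delta,a}$ be the set of functions $u:\mathbf{R}\to\mathbf{R}$ of bounded variation with $u(t)=0$ for $t\le 0$ and with values in $\left(-\frac{1-\delta}{a},\frac{1-\delta}{a}\right)$. Let $u\in\mathcal{U}_{\delta,a}$. An approximating sequence of $u$ is a sequence $(u_n)_n$ of piecewise constant functions in $\mathcal{U}_{\delta,a}$ (with finitely many pieces on every bounded interval) such that $u_n(t)\to u(t)$ for every $t\in\mathbf{R}$ and $TV_{[0,T]}(u_n)\le TV_{[0,T]}(u)$ for every $n$. For $c\in\mathbf{R}$ let $e^{t(A+cB)}$ be the strongly continuous one-parameter unitary group generated by $A+cB$. For a piecewise constant $v\in\mathcal{U}_{\delta,a}$ and $t\ge 0$, let $\Upsilon^{v}_{(t,0)}=e^{t_p(A+v_pB)}\cdots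 e^{t_1(A+v_1B)}$, where $0=s_0<s_1<\dots<s_p=t$ is a partition such that $v$ takes the constant value $v_k$ on $(s_{k-1},s_k)$, and $t_k=s_k-s_{k-1}$. Then: 1. for every $c\in(-1/a,1/a)$, $A+cB$ generates a unique strongly continuous one-parameter unitary group, so that these propagators are defined; 2. for every approximating sequence $(u_n)_n$ of $u$, every $t\in[0,T]$ and every $\psi\in D(A)$, the sequence $(\Upsilon^{u_n}_{(t,0)}\psi)_{n\in\mathbf{N}}$ is Cauchy for the norm of $H$; 3. this defines the propagator of $u$: approximating sequences of $u$ exist and, for every $t\in[0,T]$, there is a unique bounded linear operator $\Upsilon^u_{(t,0)}$ on $H$ of norm at most $1$ such that $\Upsilon^{u_n}_{(t,0)}\psi\to\Upsilon^u_{(t,0)}\psi$ for every approximating sequence $(u_n)_n$ of $u$ and every $\psi\in D(A)$. -/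

import Mathlib

open Filter Topology Set

namespace BilinearControl

section Operators

variable {H : Type*} [NormedAddCommGroup H] [InnerProductSpace ℂ H] [CompleteSpace H]

/-- A (possibly unbounded) densely defined operator `S` is skew-adjoint: `S† = -S`
(equality of operators, including equality of domains). -/
def IsSkewAdjoint (S : H →ₗ.[ℂ] H) : Prop :=
  Dense (S.domain : Set H) ∧ S.adjoint = -S

/-- `B` is skew-symmetric: `⟨Bx, y⟩ = -⟨x, By⟩` on its domain. -/
def IsSkewSymmetric (B : H →ₗ.[ℂ] H) : Prop :=
  ∀ x y : B.domain, inner ℂ (B x) (y : H) = - inner ℂ (x : H) (B y)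

/-- The standing hypothesis on the pair `(A, B)`, with the constants `a, b` of the relative
bound made explicit. -/
structure AdmissiblePair (A B : H →ₗ.[ℂ] H) (a b : ℝ) : Prop where
  skewAdjoint : IsSkewAdjoint A
  /-- `iA` is bounded from below. -/
  boundedBelow : ∃ m : ℝ, ∀ x : A.domain,
    m * ‖(x : H)‖ ^ 2 ≤ (inner ℂ (x : H) (Complex.I • A x)).re
  skewSymmetric : IsSkewSymmetric B
  a_nonneg : 0 ≤ a
  b_nonneg : 0 ≤ b
  domain_le : A.domain ≤ B.domain
  /-- `‖Bx‖ ≤ a ‖Ax‖ + b ‖x‖` for every `x` in `D(A)`. -/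
  relBound : ∀ x : A.domain, ‖B ⟨x, domain_le x.2⟩‖ ≤ a * ‖A x‖ + b * ‖(x : H)‖

/-- A strongly continuous one-parameter group of unitary operators. -/
structure IsUnitaryGroup (U : ℝ → H →L[ℂ] H) : Prop where
  unitary_mem : ∀ t, U t ∈ unitary (H →L[ℂ] H)
  map_zero : U 0 = 1
  map_add : ∀ s t, U (s + t) = U s * U t
  continuous_orbit : ∀ ψ : H, Continuous fun t => U t ψ

/-- `S` is the infinitesimal generator of `U`: `ψ` belongs to `D(S)` with `Sψ = φ` exactly when
`t ↦ U t ψ` is differentiable at `0` with derivative `φ`. -/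
def IsGenerator (S : H →ₗ.[ℂ] H) (U : ℝ → H →L[ℂ] H) : Prop :=
  ∀ ψ φ : H, (ψ, φ) ∈ S.graph ↔ HasDerivAt (fun t : ℝ => U t ψ) φ 0

open Classical in
/-- `e^{tS}`: the strongly continuous unitary group generated by `S`
(the identity, by convention, if `S` generates no such group). -/
noncomputable def unitaryExp (S : H →ₗ.[ℂ] H) (t : ℝ) : H →L[ℂ] H :=
  if h : ∃ U : ℝ → H →L[ℂ] H, IsUnitaryGroup U ∧ IsGenerator S U then h.choose t else 1

end Operators

section Controls

/-- `0 = s 0 < s 1 < ⋯ < s p = t` is a partition of `[0,t]` such that `u` is constant on each open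
interval `(s k, s (k+1))`. -/
structure IsSwitchingPartition (u : ℝ → ℝ) (t : ℝ) (p : ℕ) (s : ℕ → ℝ) : Prop where
  start : s 0 = 0
  finish : s p = t
  lt_succ : ∀ k < p, s k < s (k + 1)
  const : ∀ k < p, ∃ c : ℝ, ∀ r ∈ Ioo (s k) (s (k + 1)), u r = c

/-- `u` is piecewise constant on every interval `[0,t]`, with finitely many pieces. -/
def IsPiecewiseConstant (u : ℝ → ℝ) : Prop :=
  ∀ t : ℝ, 0 ≤ t → ∃ (p : ℕ) (s : ℕ → ℝ), IsSwitchingPartition u t p s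

/-- The controls of bounded variation on `ℝ`, vanishing on `(-∞, 0]`, with values in
`(-(1-δ)/a, (1-δ)/a)`. -/
def controlSet (δ a : ℝ) : Set (ℝ → ℝ) :=
  {u | BoundedVariationOn u univ ∧ (∀ t ≤ 0, u t = 0) ∧
    ∀ t, u t ∈ Ioo (-((1 - δ) / a)) ((1 - δ) / a)}

/-- `v` is a sequence of piecewise constant controls in `controlSet δ a` which converges pointwise
to `u` and whose total variations on `[0,T]` are at most that of `u`. -/
structure IsApproximation (δ a T : ℝ) (u : ℝ → ℝ) (v : ℕ → ℝ → ℝ) : Prop where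
  mem : ∀ n, v n ∈ controlSet δ a
  piecewiseConstant : ∀ n, IsPiecewiseConstant (v n)
  tendsto : ∀ t, Tendsto (fun n => v n t) atTop (𝓝 (u t))
  variation_le : ∀ n, eVariationOn (v n) (Icc 0 T) ≤ eVariationOn u (Icc 0 T)

end Controls

section Propagator

variable {H : Type*} [NormedAddCommGroup H] [InnerProductSpace ℂ H] [CompleteSpace H]

/-- Concatenation `e^{t_p (A + u_p B)} ∘ ⋯ ∘ e^{t_1 (A + u_1 B)}` along the partition `s`, where
`t_k = s k - s (k-1)` and `u_k` is the value of `u` at the midpoint of `(s (k-1), s k)`. -/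
noncomputable def concatenation (A B : H →ₗ.[ℂ] H) (u : ℝ → ℝ) (s : ℕ → ℝ) : ℕ → H →L[ℂ] H
  | 0 => 1
  | k + 1 =>
      unitaryExp (A + ((u ((s k + s (k + 1)) / 2) : ℝ) : ℂ) • B) (s (k + 1) - s k) *
        concatenation A B u s k

open Classical in
/-- The propagator `Υ^u_{(t,0)}` of `ψ' = (A + u(t) B) ψ` for a piecewise constant control `u` and
`t ≥ 0`: the concatenation along a partition of `[0,t]` on whose open intervals `u` is constant.
(By the group property it does not depend on the partition; the value is the identity,
by convention, if there is no such partition.) -/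
noncomputable def propagator (A B : H →ₗ.[ℂ] H) (u : ℝ → ℝ) (t : ℝ) : H →L[ℂ] H :=
  if h : ∃ q : ℕ × (ℕ → ℝ), IsSwitchingPartition u t q.1 q.2 then
    concatenation A B u h.choose.2 h.choose.1
  else 1

end Propagator

end BilinearControl

/-! Two piecewise constant controls are compared through their trajectories `x`, `y` from the same
`ψ` in `D(A)`. Skew-symmetry cancels `A + wB` in the derivative of `‖x - y‖²`, leaving `2 Re⟨x - y,
(v - w)Bx⟩`. If `‖Bx‖` is bounded by a constant `M` independent of the control, integration gives
`‖x - y‖² ≤ 4‖ψ‖M ∫|v - w|` (`norm_sub_sq_le_integral`). Approximating sequences converge in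
`L¹(0,t)` by dominated convergence, which yields both the Cauchy property and the independence of
the limit.

The uniform constant comes from total variation (`exists_expChain_bound`). On a piece where the
control is `c`, the flow preserves `‖(A + cB)x‖`; a jump of size `Δ` multiplies this norm by at most
`1 + (a/δ)|Δ| ≤ exp((a/δ)|Δ|)`. The product of these factors is controlled by the variation of `u`.

The groups exist by Stone's theorem (`IsMaxSkew.exists_isUnitaryGroup`) and Kato-Rellich
(`isMaxSkew_add_smul`). Approximating sequences are obtained by composing `u` with monotone step
functions (`exists_isApproximation`). Contractivity and density of `D(A)` extend the limit to `H`.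
-/

open Filter Topology Set

namespace BilinearControl

/-! ### Resolvents of maximal skew-symmetric operators and their bounded approximations -/

section Stone

variable {H : Type*} [NormedAddCommGroup H] [InnerProductSpace ℂ H]

/-- The graph of a densely defined skew-symmetric operator `S` such that `l - S` is onto for every
real `l ≠ 0`. -/
structure IsMaxSkew (G : Submodule ℂ (H × H)) : Prop where
  dense : Dense {x : H | ∃ y, (x, y) ∈ G}
  skew : ∀ p ∈ G, ∀ q ∈ G, inner ℂ p.2 q.1 = - inner ℂ p.1 q.2
  surj : ∀ l : ℝ, l ≠ 0 → ∀ y : H, ∃ x : H, (x, (l : ℂ) • x - y) ∈ G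

theorem re_inner_eq_zero_of_skew {x y : H} (h : inner ℂ y x = - inner ℂ x y) :
    (inner ℂ x y).re = 0 := by
  have h1 := congrArg Complex.re h
  have h2 := inner_re_symm (𝕜 := ℂ) x y
  simp only [Complex.neg_re] at h1
  simp only [RCLike.re_eq_complex_re] at h2
  linarith

/-- The cross term vanishes; this Pythagorean identity is the source of every resolvent bound below.
-/
theorem norm_sq_smul_sub_of_re_inner_eq_zero {x y : H} (h : (inner ℂ x y).re = 0) (l : ℝ) :
    ‖(l : ℂ) • x - y‖ ^ 2 = l ^ 2 * ‖x‖ ^ 2 + ‖y‖ ^ 2 := by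
  rw [@norm_sub_sq ℂ, inner_smul_left, norm_smul]
  simp [h, mul_pow]

theorem IsMaxSkew.re_inner {G : Submodule ℂ (H × H)} (hG : IsMaxSkew G) {x y : H}
    (h : (x, y) ∈ G) : (inner ℂ x y).re = 0 :=
  re_inner_eq_zero_of_skew (hG.skew _ h _ h)

theorem IsMaxSkew.norm_le {G : Submodule ℂ (H × H)} (hG : IsMaxSkew G) {l : ℝ} {x y : H}
    (h : (x, (l : ℂ) • x - y) ∈ G) : |l| * ‖x‖ ≤ ‖y‖ := by
  have h1 := norm_sq_smul_sub_of_re_inner_eq_zero (hG.re_inner h) l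
  rw [sub_sub_cancel] at h1
  refine abs_le_of_sq_le_sq' ?_ (norm_nonneg _) |>.2
  rw [mul_pow, sq_abs, h1]
  linarith [sq_nonneg ‖(l : ℂ) • x - y‖]

theorem IsMaxSkew.unique {G : Submodule ℂ (H × H)} (hG : IsMaxSkew G) {l : ℝ} (hl : l ≠ 0)
    {x x' y : H} (h : (x, (l : ℂ) • x - y) ∈ G) (h' : (x', (l : ℂ) • x' - y) ∈ G) : x = x' := by
  have h1 := G.sub_mem h h'
  have h2 : (x - x', (l : ℂ) • (x - x') - 0) ∈ G := by
    convert h1 using 1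
    ext <;> simp [smul_sub]
  have h3 := hG.norm_le h2
  rw [norm_zero] at h3
  have h4 : 0 < |l| := abs_pos.2 hl
  have h5 : ‖x - x'‖ ≤ 0 := by
    by_contra! h
    nlinarith
  exact sub_eq_zero.1 (norm_le_zero_iff.1 h5)

theorem IsMaxSkew.exists_resolvent {G : Submodule ℂ (H × H)} (hG : IsMaxSkew G) {l : ℝ}
    (hl : l ≠ 0) : ∃ R : H →L[ℂ] H, ∀ y, (R y, (l : ℂ) • R y - y) ∈ G := by
  choose R hR using hG.surj l hl
  let R' : H →ₗ[ℂ] H :=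
    { toFun := R
      map_add' := fun y z => by
        refine hG.unique hl (hR _) ?_
        convert G.add_mem (hR y) (hR z) using 1
        ext
        · simp
        · simp only [smul_add, Prod.mk_add_mk]; abel
      map_smul' := fun c y => by
        refine hG.unique hl (hR _) ?_
        convert G.smul_mem c (hR y) using 1
        ext
        · simp
        · simp [smul_sub, smul_comm c] }
  refine ⟨R'.mkContinuous |l|⁻¹ fun y => ?_, fun y => hR y⟩
  have := hG.norm_le (hR y)
  have h4 : 0 < |l| := abs_pos.2 hl
  change ‖R y‖ ≤ _
  rw [inv_mul_eq_div, le_div_iff₀ h4]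
  linarith

open Classical in
/-- The resolvent `(l - S)⁻¹` of an operator `S` with graph `G`, for real `l ≠ 0`. -/
noncomputable def resolventAt (G : Submodule ℂ (H × H)) (l : ℝ) : H →L[ℂ] H :=
  if h : ∃ R : H →L[ℂ] H, ∀ y, (R y, (l : ℂ) • R y - y) ∈ G then h.choose else 0

namespace IsMaxSkew

variable {G : Submodule ℂ (H × H)} (hG : IsMaxSkew G)
include hG

theorem resolventAt_mem {l : ℝ} (hl : l ≠ 0) (y : H) :
    (resolventAt G l y, (l : ℂ) • resolventAt G l y - y) ∈ G := by
  rw [resolventAt, dif_pos (hG.exists_resolvent hl)]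
  exact (hG.exists_resolvent hl).choose_spec y

theorem resolventAt_eq {l : ℝ} (hl : l ≠ 0) {x y : H} (h : (x, (l : ℂ) • x - y) ∈ G) :
    resolventAt G l y = x :=
  hG.unique hl (hG.resolventAt_mem hl y) h

theorem resolventAt_sub {l : ℝ} (hl : l ≠ 0) {x y : H} (h : (x, y) ∈ G) :
    (l : ℂ) • resolventAt G l x - x = resolventAt G l y := by
  have : resolventAt G l ((l : ℂ) • x - y) = x := hG.resolventAt_eq hl (by simpa using h)
  rw [map_sub, map_smul] at this
  rw [← sub_eq_zero, sub_right_comm, sub_eq_zero]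
  exact this

theorem norm_resolventAt_le {l : ℝ} (hl : l ≠ 0) (y : H) :
    |l| * ‖resolventAt G l y‖ ≤ ‖y‖ :=
  hG.norm_le (hG.resolventAt_mem hl y)

theorem resolventAt_comm {l m : ℝ} (hl : l ≠ 0) (hm : m ≠ 0) :
    Commute (resolventAt G l) (resolventAt G m) := by
  ext y
  simp only [mul_apply_eq_comp]
  symm
  set w := resolventAt G m y with hw
  set x := resolventAt G l w with hx
  have h1 := hG.resolventAt_mem hm y
  have h2 := hG.resolventAt_mem hl w
  rw [← hw] at h1
  rw [← hx] at h2
  -- This is the resolvent identity; it exhibits `x` as a solution of `(m - S)x = R(l)y`.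
  have h3 : resolventAt G l y = w + ((m - l : ℝ) : ℂ) • x := by
    apply hG.resolventAt_eq hl
    convert G.add_mem h1 (G.smul_mem ((m - l : ℝ) : ℂ) h2) using 1
    ext
    · simp
    · simp only [Prod.snd_add, Prod.smul_snd]
      push_cast
      module
  apply hG.resolventAt_eq hm
  rw [h3]
  convert h2 using 2
  push_cast
  module

theorem inner_resolventAt {l : ℝ} (hl : l ≠ 0) (y z : H) :
    inner ℂ (resolventAt G l y) z = - inner ℂ y (resolventAt G (-l) z) := by
  have h1 := hG.skew _ (hG.resolventAt_mem hl y) _ (hG.resolventAt_mem (neg_ne_zero.2 hl) z)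
  simp only [inner_sub_left, inner_sub_right, inner_smul_left, inner_smul_right,
    Complex.conj_ofReal, Complex.ofReal_neg] at h1
  linear_combination -h1

variable [CompleteSpace H]

theorem adjoint_resolventAt {l : ℝ} (hl : l ≠ 0) :
    star (resolventAt G l) = - resolventAt G (-l) := by
  rw [ContinuousLinearMap.star_eq_adjoint]
  symm
  rw [ContinuousLinearMap.eq_adjoint_iff]
  intro y z
  have := hG.inner_resolventAt (neg_ne_zero.2 hl) y z
  rw [neg_neg] at this
  rw [neg_apply, inner_neg_left, this, neg_neg]

end IsMaxSkew

/-- Bounded skew-adjoint approximation `n² S (n² - S²)⁻¹` (with `n + 1` in place of `n`). -/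
noncomputable def yosida (G : Submodule ℂ (H × H)) (n : ℕ) : H →L[ℂ] H :=
  ((((n : ℝ) + 1) ^ 2 / 2 : ℝ) : ℂ) • (resolventAt G (n + 1) + resolventAt G (-(n + 1)))

namespace IsMaxSkew

variable {G : Submodule ℂ (H × H)} (hG : IsMaxSkew G)
include hG

theorem commute_yosida (m n : ℕ) : Commute (yosida G m) (yosida G n) := by
  have hm : ((m : ℝ) + 1) ≠ 0 := by positivity
  have hn : ((n : ℝ) + 1) ≠ 0 := by positivity
  have hm' := neg_ne_zero.2 hm
  have hn' := neg_ne_zero.2 hn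
  refine Commute.smul_left (Commute.smul_right ?_ _) _
  exact (((hG.resolventAt_comm hm hn).add_right (hG.resolventAt_comm hm hn'))).add_left
    ((hG.resolventAt_comm hm' hn).add_right (hG.resolventAt_comm hm' hn'))

/-- For `x` in the domain the error is `R(l)Sx`, of norm at most `‖Sx‖/|l|`; contractivity of `l
R(l)` and density do the rest. -/
theorem tendsto_smul_resolventAt {l : ℕ → ℝ} (hl : ∀ n, |l n| = n + 1) (y : H) :
    Tendsto (fun n => (l n : ℂ) • resolventAt G (l n) y) atTop (𝓝 y) := by
  have hl0 : ∀ n, l n ≠ 0 := fun n => by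
    rw [← abs_pos, hl]; positivity
  rw [Metric.tendsto_atTop]
  intro ε hε
  obtain ⟨x, hx, z, hxz⟩ := Metric.dense_iff.1 hG.dense y (ε / 3) (by positivity)
  rw [Metric.mem_ball, dist_eq_norm] at hx
  obtain ⟨N, hN⟩ := exists_nat_gt (‖z‖ / (ε / 3))
  refine ⟨N, fun n hn => ?_⟩
  have h1 : ‖(l n : ℂ) • resolventAt G (l n) x - x‖ < ε / 3 := by
    rw [hG.resolventAt_sub (hl0 n) hxz]
    have h2 := hG.norm_resolventAt_le (hl0 n) z
    rw [hl] at h2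
    have hn' : (N : ℝ) ≤ n := by exact_mod_cast hn
    rw [div_lt_iff₀ (by positivity)] at hN
    by_contra! h
    nlinarith
  have h3 : ‖(l n : ℂ) • resolventAt G (l n) (y - x)‖ ≤ ‖y - x‖ := by
    rw [norm_smul, Complex.norm_real, Real.norm_eq_abs]
    exact hG.norm_resolventAt_le (hl0 n) _
  have h4 : (l n : ℂ) • resolventAt G (l n) y - y =
      (l n : ℂ) • resolventAt G (l n) (y - x) + ((l n : ℂ) • resolventAt G (l n) x - x)
        + (x - y) := by
    rw [map_sub, smul_sub]; abel
  rw [norm_sub_rev] at h3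
  rw [dist_eq_norm, h4]
  refine (norm_add₃_le).trans_lt ?_
  linarith

theorem yosida_apply {x y : H} (h : (x, y) ∈ G) (n : ℕ) :
    yosida G n x = (2⁻¹ : ℂ) • ((((n + 1 : ℝ)) : ℂ) • resolventAt G (n + 1) y
      + (((-(n + 1) : ℝ)) : ℂ) • resolventAt G (-(n + 1)) y) := by
  have hn : ((n : ℝ) + 1) ≠ 0 := by positivity
  rw [← hG.resolventAt_sub hn h, ← hG.resolventAt_sub (neg_ne_zero.2 hn) h, yosida]
  simp only [smul_apply, add_apply]
  push_cast
  module

theorem tendsto_yosida {x y : H} (h : (x, y) ∈ G) :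
    Tendsto (fun n => yosida G n x) atTop (𝓝 y) := by
  simp_rw [hG.yosida_apply h]
  have h1 := hG.tendsto_smul_resolventAt (l := fun n => n + 1)
    (fun n => abs_of_pos (by positivity)) y
  have h2 := hG.tendsto_smul_resolventAt (l := fun n => -(n + 1))
    (fun n => by rw [abs_neg]; exact abs_of_pos (by positivity)) y
  convert (h1.add h2).const_smul (2⁻¹ : ℂ) using 2
  module

variable [CompleteSpace H]

/-- The adjoint exchanges the resolvents at `±(n + 1)` up to sign. Using both points is what makes
the exponentials unitary, for negative times too. -/
theorem star_yosida (n : ℕ) : star (yosida G n) = - yosida G n := by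
  have hn : ((n : ℝ) + 1) ≠ 0 := by positivity
  rw [yosida, star_smul, star_add, hG.adjoint_resolventAt hn,
    hG.adjoint_resolventAt (neg_ne_zero.2 hn), neg_neg, ← smul_neg]
  congr 1
  · exact Complex.conj_ofReal _
  · abel

end IsMaxSkew

section BoundedExponential

variable [CompleteSpace H]

theorem norm_apply_of_mem_unitary {U : H →L[ℂ] H} (hU : U ∈ unitary (H →L[ℂ] H)) (x : H) :
    ‖U x‖ = ‖x‖ :=
  ContinuousLinearMap.norm_map_of_mem_unitary hU x

theorem exp_smul_mem_unitary {K : H →L[ℂ] H} (hK : star K = -K) (t : ℝ) :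
    NormedSpace.exp (t • K) ∈ unitary (H →L[ℂ] H) := by
  let _ : NormedAlgebra ℚ (H →L[ℂ] H) := .restrictScalars ℚ ℂ _
  apply NormedSpace.exp_mem_unitary_of_mem_skewAdjoint
  rw [skewAdjoint.mem_iff, star_smul, hK]
  simp

theorem hasDerivAt_exp_smul_apply (K : H →L[ℂ] H) (x : H) (t : ℝ) :
    HasDerivAt (fun t : ℝ => NormedSpace.exp (t • K) x) (NormedSpace.exp (t • K) (K x)) t := by
  have h := hasDerivAt_exp_smul_const (𝕂 := ℝ) K t
  exact ((ContinuousLinearMap.apply ℂ H x).restrictScalars ℝ).hasFDerivAt.comp_hasDerivAt t h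

theorem norm_exp_smul_apply_sub_le {K : H →L[ℂ] H} (hK : star K = -K) (t : ℝ) (x : H) :
    ‖NormedSpace.exp (t • K) x - x‖ ≤ |t| * ‖K x‖ := by
  have h := Convex.norm_image_sub_le_of_norm_hasDerivWithin_le (𝕜 := ℝ) (s := Set.univ) (x := 0)
    (y := t) (C := ‖K x‖) (fun t _ => (hasDerivAt_exp_smul_apply K x t).hasDerivWithinAt)
    (fun t _ => (norm_apply_of_mem_unitary (exp_smul_mem_unitary hK t) _).le)
    convex_univ trivial trivial
  simpa [mul_comm] using h

/-- By commutation `exp(tK) = exp(tL) exp(t(K - L))`, and the unitary factor drops out of the norm.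
-/
theorem norm_exp_smul_apply_sub_exp_le {K L : H →L[ℂ] H} (hK : star K = -K) (hL : star L = -L)
    (hKL : Commute K L) (t : ℝ) (x : H) :
    ‖NormedSpace.exp (t • K) x - NormedSpace.exp (t • L) x‖ ≤ |t| * ‖K x - L x‖ := by
  have hKL' : star (K - L) = -(K - L) := by rw [star_sub, hK, hL]; abel
  have hc : Commute (t • L) (t • (K - L)) :=
    ((hKL.symm.sub_right (Commute.refl L)).smul_left t).smul_right t
  have : NormedSpace.exp (t • K) = NormedSpace.exp (t • L) * NormedSpace.exp (t • (K - L)) := by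
    let _ : NormedAlgebra ℚ (H →L[ℂ] H) := .restrictScalars ℚ ℂ _
    have := NormedSpace.exp_add_of_commute hc
    rw [← this, ← smul_add, add_sub_cancel]
  rw [this, mul_apply_eq_comp, ← map_sub,
    norm_apply_of_mem_unitary (exp_smul_mem_unitary hL t)]
  exact norm_exp_smul_apply_sub_le hKL' t x

end BoundedExponential

end Stone

end BilinearControl

namespace BilinearControl

/-! ### Stone's theorem: existence and uniqueness of the unitary group -/

section StoneTheorem

variable {H : Type*} [NormedAddCommGroup H] [InnerProductSpace ℂ H] [CompleteSpace H]

/-- A sequence of contractions which is Cauchy pointwise on a dense set converges pointwise to a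
contraction. -/
theorem exists_tendsto_of_cauchySeq_of_dense {V : ℕ → H →L[ℂ] H} (hV : ∀ n x, ‖V n x‖ ≤ ‖x‖)
    {D : Set H} (hD : Dense D) (h : ∀ x ∈ D, CauchySeq fun n => V n x) :
    ∃ W : H →L[ℂ] H, ‖W‖ ≤ 1 ∧ ∀ x, Tendsto (fun n => V n x) atTop (𝓝 (W x)) := by
  have hc : ∀ x, CauchySeq fun n => V n x := by
    intro x
    rw [Metric.cauchySeq_iff]
    intro ε hε
    obtain ⟨y, hy, hyD⟩ := Metric.dense_iff.1 hD x (ε / 3) (by positivity)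
    rw [Metric.mem_ball, dist_eq_norm] at hy
    obtain ⟨N, hN⟩ := Metric.cauchySeq_iff.1 (h y hyD) (ε / 3) (by positivity)
    refine ⟨N, fun m hm n hn => ?_⟩
    have h1 := hN m hm n hn
    rw [dist_eq_norm] at h1 ⊢
    have h2 : V m x - V n x = (V n (y - x) - V m (y - x)) + (V m y - V n y) := by
      simp only [map_sub]; abel
    rw [h2]
    have h3 := norm_sub_le (V n (y - x)) (V m (y - x))
    have h4 := hV n (y - x)
    have h5 := hV m (y - x)
    refine (norm_add_le _ _).trans_lt ?_
    linarith
  choose f hf using fun x => cauchySeq_tendsto_of_complete (hc x)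
  refine ⟨continuousLinearMapOfTendsto V (tendsto_pi_nhds.2 hf), ?_, hf⟩
  refine ContinuousLinearMap.opNorm_le_bound _ zero_le_one fun x => ?_
  rw [one_mul]
  exact le_of_tendsto (hf x).norm (Eventually.of_forall fun n => hV n x)

namespace IsUnitaryGroup

variable {U : ℝ → H →L[ℂ] H} (hU : IsUnitaryGroup U)
include hU

theorem norm_apply (t : ℝ) (x : H) : ‖U t x‖ = ‖x‖ :=
  norm_apply_of_mem_unitary (hU.unitary_mem t) x

theorem map_add_apply (s t : ℝ) (x : H) : U (s + t) x = U s (U t x) := by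
  rw [hU.map_add, mul_apply_eq_comp]

theorem map_zero_apply (x : H) : U 0 x = x := by
  rw [hU.map_zero, one_apply_eq_self]

theorem hasDerivAt_apply {x y : H} (h : HasDerivAt (fun t : ℝ => U t x) y 0) (t : ℝ) :
    HasDerivAt (fun s : ℝ => U s x) (U t y) t := by
  have h1 : HasDerivAt (fun s : ℝ => U (s - t) x) y t :=
    HasDerivAt.comp_sub_const t t (by simpa using h)
  have h2 := ((U t).restrictScalars ℝ).hasFDerivAt.comp_hasDerivAt t h1
  refine h2.congr_of_eventuallyEq (Eventually.of_forall fun s => ?_)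
  change U s x = U t (U (s - t) x)
  rw [← hU.map_add_apply, add_sub_cancel]

theorem hasDerivAt_apply_zero {x y : H} (h : HasDerivAt (fun t : ℝ => U t x) y 0) (t : ℝ) :
    HasDerivAt (fun s : ℝ => U s (U t x)) (U t y) 0 := by
  have h2 := ((U t).restrictScalars ℝ).hasFDerivAt.comp_hasDerivAt 0 h
  refine h2.congr_of_eventuallyEq (Eventually.of_forall fun s => ?_)
  change U s (U t x) = U t (U s x)
  rw [← hU.map_add_apply, ← hU.map_add_apply, add_comm]

theorem re_inner_eq_zero {x y : H} (h : HasDerivAt (fun t : ℝ => U t x) y 0) :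
    (inner ℂ x y).re = 0 := by
  let _ : InnerProductSpace ℝ H := InnerProductSpace.rclikeToReal ℂ H
  have h1 := h.norm_sq
  simp only [hU.norm_apply] at h1
  have h2 := h1.unique (hasDerivAt_const _ _)
  rw [hU.map_zero_apply] at h2
  have h3 : inner ℝ x y = (inner ℂ x y).re := rfl
  linarith

theorem _root_.BilinearControl.IsGenerator.map_mem {S : H →ₗ.[ℂ] H} (hS : IsGenerator S U)
    {x y : H} (h : (x, y) ∈ S.graph) (t : ℝ) : (U t x, U t y) ∈ S.graph :=
  (hS _ _).2 (hU.hasDerivAt_apply_zero ((hS _ _).1 h) t)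

/-- Both orbits stay in the domain, so their difference `z` satisfies `(‖z‖²)' = 2 Re⟨z, Sz⟩ = 0`.
-/
theorem eq_of_isGenerator {W : ℝ → H →L[ℂ] H} (hW : IsUnitaryGroup W) {S : H →ₗ.[ℂ] H}
    (hd : Dense (S.domain : Set H)) (hSU : IsGenerator S U) (hSW : IsGenerator S W) : U = W := by
  let _ : InnerProductSpace ℝ H := InnerProductSpace.rclikeToReal ℂ H
  ext1 t
  refine ContinuousLinearMap.ext_on (s := (S.domain : Set H)) ?_ ?_
  · exact hd.mono Submodule.subset_span
  intro x hx
  have hg : (x, S ⟨x, hx⟩) ∈ S.graph := S.mem_graph ⟨x, hx⟩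
  set y := S ⟨x, hx⟩
  have hder : ∀ s, HasDerivAt (fun s => ‖U s x - W s x‖ ^ 2) 0 s := by
    intro s
    have h1 := ((hU.hasDerivAt_apply ((hSU _ _).1 hg) s).sub
      (hW.hasDerivAt_apply ((hSW _ _).1 hg) s)).norm_sq
    have h2 := S.graph.sub_mem (hSU.map_mem hU hg s) (hSW.map_mem hW hg s)
    have h3 := hU.re_inner_eq_zero ((hSU _ _).1 h2)
    have h4 : inner ℝ (U s x - W s x) (U s y - W s y) =
      (inner ℂ (U s x - W s x) (U s y - W s y)).re := rfl
    simp only [Pi.sub_apply] at h1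
    rw [h4, h3, mul_zero] at h1
    exact h1
  have hconst := is_const_of_deriv_eq_zero (fun s => (hder s).differentiableAt)
    (fun s => (hder s).deriv) t 0
  simp only [hU.map_zero, hW.map_zero, sub_self, norm_zero] at hconst
  have h0 : ‖U t x - W t x‖ = 0 := by
    rw [← sq_eq_zero_iff, hconst]; simp
  exact sub_eq_zero.1 (norm_eq_zero.1 h0)

end IsUnitaryGroup

/-- The generator cannot properly extend `G`: `1 - S` is already onto, and `1` minus the generator
is injective because the generator has `Re⟨x, y⟩ = 0`. -/
theorem IsMaxSkew.mem_of_hasDerivAt {G : Submodule ℂ (H × H)} (hG : IsMaxSkew G)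
    {U : ℝ → H →L[ℂ] H} (hU : IsUnitaryGroup U)
    (h : ∀ x y, (x, y) ∈ G → HasDerivAt (fun t : ℝ => U t x) y 0) {x y : H}
    (hxy : HasDerivAt (fun t : ℝ => U t x) y 0) : (x, y) ∈ G := by
  obtain ⟨z, hz⟩ := hG.surj 1 one_ne_zero (x - y)
  simp only [Complex.ofReal_one, one_smul] at hz
  have h1 : HasDerivAt (fun t : ℝ => U t (x - z)) (y - (z - (x - y))) 0 := by
    simpa only [map_sub] using! hxy.sub (h _ _ hz)
  have h2 : y - (z - (x - y)) = x - z := by abel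
  rw [h2] at h1
  have h3 := hU.re_inner_eq_zero h1
  have h4 : x - z = 0 := (inner_self_eq_zero (𝕜 := ℂ)).1 (by
    apply Complex.ext
    · simpa using h3
    · exact inner_self_im (𝕜 := ℂ) (x - z))
  have h5 : x = z := sub_eq_zero.1 h4
  subst h5
  simpa using hz

/-- **Stone's theorem**: a maximal skew-symmetric operator generates a unitary group. -/
theorem IsMaxSkew.exists_isUnitaryGroup {G : Submodule ℂ (H × H)} (hG : IsMaxSkew G) :
    ∃ U : ℝ → H →L[ℂ] H, IsUnitaryGroup U ∧
      ∀ x y, (x, y) ∈ G ↔ HasDerivAt (fun t : ℝ => U t x) y 0 := by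
  set E : ℕ → ℝ → H →L[ℂ] H := fun n t => NormedSpace.exp (t • yosida G n) with hE
  have hE_unit : ∀ n t, E n t ∈ unitary (H →L[ℂ] H) := fun n t =>
    exp_smul_mem_unitary (hG.star_yosida n) t
  have hE_norm : ∀ n t x, ‖E n t x‖ = ‖x‖ := fun n t x =>
    norm_apply_of_mem_unitary (hE_unit n t) x
  have hE_diff : ∀ m n t x, ‖E m t x - E n t x‖ ≤ |t| * ‖yosida G m x - yosida G n x‖ :=
    fun m n t x => norm_exp_smul_apply_sub_exp_le (hG.star_yosida m) (hG.star_yosida n)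
      (hG.commute_yosida m n) t x
  have hlim : ∀ t, ∃ W : H →L[ℂ] H, ‖W‖ ≤ 1 ∧ ∀ x, Tendsto (fun n => E n t x) atTop (𝓝 (W x)) := by
    intro t
    refine exists_tendsto_of_cauchySeq_of_dense (fun n x => (hE_norm n t x).le) hG.dense ?_
    rintro x ⟨y, hxy⟩
    rw [Metric.cauchySeq_iff]
    intro ε hε
    obtain ⟨N, hN⟩ := Metric.cauchySeq_iff.1 (hG.tendsto_yosida hxy).cauchySeq (ε / (|t| + 1))
      (by positivity)
    refine ⟨N, fun m hm n hn => ?_⟩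
    have h1 := hN m hm n hn
    rw [dist_eq_norm, lt_div_iff₀ (by positivity)] at h1
    rw [dist_eq_norm]
    refine (hE_diff m n t x).trans_lt ?_
    nlinarith [norm_nonneg (yosida G m x - yosida G n x)]
  choose U _ hUlim using hlim
  have hU_norm : ∀ t x, ‖U t x‖ = ‖x‖ := fun t x =>
    tendsto_nhds_unique (hUlim t x).norm (by simp only [hE_norm, tendsto_const_nhds])
  have hU0 : U 0 = 1 := by
    ext x
    refine tendsto_nhds_unique (hUlim 0 x) ?_
    simp [hE]
  have hUadd : ∀ s t, U (s + t) = U s * U t := by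
    intro s t
    ext x
    refine tendsto_nhds_unique (hUlim (s + t) x) ?_
    have h1 : ∀ n, E n (s + t) x = E n s (E n t x) := by
      intro n
      let _ : NormedAlgebra ℚ (H →L[ℂ] H) := .restrictScalars ℚ ℂ _
      have := NormedSpace.exp_add_of_commute
        (((Commute.refl (yosida G n)).smul_left s).smul_right t)
      rw [← mul_apply_eq_comp, hE]
      simp only [add_smul, this]
    simp only [h1]
    rw [mul_apply_eq_comp]
    have h2 : Tendsto (fun n => E n s (E n t x - U t x)) atTop (𝓝 0) := by
      rw [tendsto_zero_iff_norm_tendsto_zero]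
      simp only [hE_norm]
      exact tendsto_iff_norm_sub_tendsto_zero.1 (hUlim t x)
    simpa using! h2.add (hUlim s (U t x))
  have hUstar : ∀ t, star (U t) = U (-t) := by
    intro t
    rw [ContinuousLinearMap.star_eq_adjoint]
    symm
    rw [ContinuousLinearMap.eq_adjoint_iff]
    intro x y
    refine tendsto_nhds_unique ((hUlim (-t) x).inner (tendsto_const_nhds (x := y)))
      (Tendsto.congr (fun n => ?_) ((tendsto_const_nhds (x := x)).inner (hUlim t y)))
    have h1 : star (E n t) = E n (-t) := by
      simp only [hE]
      rw [NormedSpace.star_exp, star_smul, hG.star_yosida]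
      simp
    rw [← h1, ContinuousLinearMap.star_eq_adjoint, ContinuousLinearMap.adjoint_inner_left]
  have hU_unit : ∀ t, U t ∈ unitary (H →L[ℂ] H) := by
    intro t
    rw [Unitary.mem_iff, hUstar, ← hUadd, ← hUadd]
    simp [hU0]
  -- Letting only one index tend to infinity leaves an error linear in `|t|`, exactly what the
  -- derivative at `0` tolerates.
  have hUE : ∀ m t x y, (x, y) ∈ G → ‖U t x - E m t x‖ ≤ |t| * ‖y - yosida G m x‖ := by
    intro m t x y hxy
    refine le_of_tendsto_of_tendsto ((hUlim t x).sub_const (E m t x)).norm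
      (((hG.tendsto_yosida hxy).sub_const (yosida G m x)).norm.const_mul |t|)
      (Eventually.of_forall fun n => hE_diff n m t x)
  have hUder : ∀ x y, (x, y) ∈ G → HasDerivAt (fun t : ℝ => U t x) y 0 := by
    intro x y hxy
    rw [hasDerivAt_iff_isLittleO, Asymptotics.isLittleO_iff]
    intro ε hε
    obtain ⟨m, hm⟩ := ((tendsto_iff_norm_sub_tendsto_zero.1
      (hG.tendsto_yosida hxy)).eventually (gt_mem_nhds (show 0 < ε / 3 by positivity))).exists
    have hd := hasDerivAt_exp_smul_apply (yosida G m) x 0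
    rw [hasDerivAt_iff_isLittleO, Asymptotics.isLittleO_iff] at hd
    filter_upwards [hd (show 0 < ε / 3 by positivity)] with t ht
    have h1 := hUE m t x y hxy
    rw [norm_sub_rev] at hm
    simp only [zero_smul, NormedSpace.exp_zero, one_apply_eq_self, sub_zero, hU0,
      Real.norm_eq_abs] at ht ⊢
    have h2 : U t x - x - t • y = (U t x - E m t x) +
        (E m t x - x - t • yosida G m x) - t • (y - yosida G m x) := by
      rw [smul_sub]; abel
    rw [h2]
    refine (norm_sub_le _ _).trans ?_
    have h3 := norm_add_le (U t x - E m t x) (E m t x - x - t • yosida G m x)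
    rw [norm_smul, Real.norm_eq_abs]
    have h4 : |t| * ‖y - yosida G m x‖ ≤ |t| * (ε / 3) := by gcongr
    linarith
  have hU0' : ∀ x, Tendsto (fun t => U t x) (𝓝 0) (𝓝 x) := by
    intro x
    rw [Metric.tendsto_nhds]
    intro ε hε
    obtain ⟨y, hy, z, hyz⟩ := Metric.dense_iff.1 hG.dense x (ε / 3) (by positivity)
    rw [Metric.mem_ball, dist_eq_norm] at hy
    have h1 := (hUder y z hyz).continuousAt
    filter_upwards [Metric.tendsto_nhds.1 h1 (ε / 3) (by positivity)] with t ht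
    rw [hU0, dist_eq_norm] at ht
    rw [dist_eq_norm]
    have h2 : U t x - x = (U t y - (1 : H →L[ℂ] H) y) + (y - x) - U t (y - x) := by
      rw [map_sub, one_apply_eq_self]; abel
    rw [h2]
    refine (norm_sub_le _ _).trans_lt ?_
    have h3 := norm_add_le (U t y - (1 : H →L[ℂ] H) y) (y - x)
    rw [hU_norm]
    linarith
  have hgrp : IsUnitaryGroup U := by
    refine ⟨hU_unit, hU0, hUadd, fun x => continuous_iff_continuousAt.2 fun t => ?_⟩
    have h1 : Tendsto (fun s => U t (U (s - t) x)) (𝓝 t) (𝓝 (U t x)) := by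
      refine ((U t).continuous.tendsto x).comp ((hU0' x).comp ?_)
      have : Tendsto (fun s : ℝ => s - t) (𝓝 t) (𝓝 (t - t)) :=
        (continuous_id.sub continuous_const).tendsto t
      simpa using this
    refine h1.congr fun s => ?_
    rw [← mul_apply_eq_comp, ← hUadd, add_sub_cancel]
  exact ⟨U, hgrp, fun x y => ⟨hUder x y, hG.mem_of_hasDerivAt hgrp hUder⟩⟩

end StoneTheorem

end BilinearControl

namespace BilinearControl

/-! ### Skew-adjoint operators are maximal; Kato-Rellich perturbation -/

section Perturbation

variable {H : Type*} [NormedAddCommGroup H] [InnerProductSpace ℂ H]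

theorem mem_graph_add_smul {A B : H →ₗ.[ℂ] H} (hAB : A.domain ≤ B.domain) {c : ℂ} {x y : H} :
    (x, y) ∈ (A + c • B).graph ↔
      ∃ hx : x ∈ A.domain, A ⟨x, hx⟩ + c • B ⟨x, hAB hx⟩ = y := by
  rw [LinearPMap.mem_graph_iff]
  constructor
  · rintro ⟨⟨z, hz⟩, rfl, rfl⟩
    exact ⟨hz.1, rfl⟩
  · rintro ⟨hx, rfl⟩
    exact ⟨⟨x, hx, hAB hx⟩, rfl, rfl⟩

theorem domain_add_smul {A B : H →ₗ.[ℂ] H} (hAB : A.domain ≤ B.domain) (c : ℂ) :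
    (A + c • B).domain = A.domain :=
  inf_eq_left.2 hAB

variable [CompleteSpace H]

/-- Skew-adjointness in weak form: it gives closedness of the graph, and puts vectors orthogonal to
the range of `l - A` into the domain. -/
theorem IsSkewAdjoint.mem_graph_iff {A : H →ₗ.[ℂ] H} (hA : IsSkewAdjoint A) {x y : H} :
    (x, y) ∈ A.graph ↔ ∀ z : A.domain, inner ℂ y (z : H) = - inner ℂ x (A z) := by
  constructor
  · intro h z
    obtain ⟨w, rfl, rfl⟩ := (LinearPMap.mem_graph_iff _).1 h
    have h1 := LinearPMap.adjoint_isFormalAdjoint (T := A) hA.1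
    rw [hA.2] at h1
    have h2 := h1 w z
    rw [LinearPMap.neg_apply, inner_neg_left] at h2
    linear_combination -h2
  · intro h
    have h1 : ∀ z : A.domain, inner ℂ (-y) (z : H) = inner ℂ x (A z) := fun z => by
      rw [inner_neg_left, h z, neg_neg]
    have h2 : x ∈ A.adjoint.domain := LinearPMap.mem_adjoint_domain_of_exists x ⟨_, h1⟩
    have h3 : A.adjoint ⟨x, h2⟩ = -y := LinearPMap.adjoint_apply_eq hA.1 ⟨x, h2⟩ h1
    have h4 : (x, -y) ∈ A.adjoint.graph := h3 ▸ A.adjoint.mem_graph ⟨x, h2⟩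
    rw [hA.2] at h4
    obtain ⟨w, rfl, h5⟩ := (LinearPMap.mem_graph_iff _).1 h4
    rw [LinearPMap.neg_apply, neg_inj] at h5
    rw [← h5]
    exact A.mem_graph w

theorem IsSkewAdjoint.isClosed_graph {A : H →ₗ.[ℂ] H} (hA : IsSkewAdjoint A) :
    IsClosed (A.graph : Set (H × H)) := by
  have : (A.graph : Set (H × H)) =
      ⋂ z : A.domain, {p : H × H | inner ℂ p.2 (z : H) = - inner ℂ p.1 (A z)} := by
    ext ⟨x, y⟩
    simp [hA.mem_graph_iff]
  rw [this]
  refine isClosed_iInter fun z => isClosed_eq ?_ ?_ <;> fun_prop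

/-- On the closed graph `l - A` is bounded below, so its range is closed. A vector `z` orthogonal to
the range satisfies `Az = -lz`, and `Re⟨z, Az⟩ = 0` forces `z = 0`. -/
theorem IsSkewAdjoint.isMaxSkew {A : H →ₗ.[ℂ] H} (hA : IsSkewAdjoint A) :
    IsMaxSkew A.graph := by
  have hskew : ∀ p ∈ A.graph, ∀ q ∈ A.graph, inner ℂ p.2 q.1 = - inner ℂ p.1 q.2 := by
    rintro ⟨x, y⟩ hp ⟨z, w⟩ hq
    obtain ⟨z, rfl, rfl⟩ := (LinearPMap.mem_graph_iff _).1 hq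
    exact hA.mem_graph_iff.1 hp z
  refine ⟨hA.1.mono fun x hx => ⟨_, A.mem_graph ⟨x, hx⟩⟩, hskew, fun l hl y => ?_⟩
  let f : A.graph →L[ℂ] H :=
    ((l : ℂ) • ContinuousLinearMap.fst ℂ H H - ContinuousLinearMap.snd ℂ H H).comp A.graph.subtypeL
  have hf : ∀ p : A.graph, ‖f p‖ ^ 2 = l ^ 2 * ‖(p : H × H).1‖ ^ 2 + ‖(p : H × H).2‖ ^ 2 :=
    fun p => norm_sq_smul_sub_of_re_inner_eq_zero
      (re_inner_eq_zero_of_skew (hskew _ p.2 _ p.2)) l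
  have hl' : 0 < |l| := abs_pos.2 hl
  have hanti : AntilipschitzWith (Real.toNNReal (1 + |l|⁻¹)) f := by
    refine ContinuousLinearMap.antilipschitz_of_bound f fun p => ?_
    rw [Real.coe_toNNReal _ (by positivity)]
    have h1 : |l| * ‖(p : H × H).1‖ ≤ ‖f p‖ := by
      refine abs_le_of_sq_le_sq' ?_ (norm_nonneg _) |>.2
      rw [mul_pow, sq_abs, hf]
      linarith [sq_nonneg ‖(p : H × H).2‖]
    have h2 : ‖(p : H × H).2‖ ≤ ‖f p‖ := by
      refine abs_le_of_sq_le_sq' ?_ (norm_nonneg _) |>.2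
      rw [hf]
      linarith [mul_nonneg (sq_nonneg l) (sq_nonneg ‖(p : H × H).1‖)]
    have h3 : ‖(p : H × H).1‖ ≤ |l|⁻¹ * ‖f p‖ := by
      rw [inv_mul_eq_div, le_div_iff₀ hl']
      linarith
    have h4 : 0 ≤ |l|⁻¹ * ‖f p‖ := by positivity
    change ‖(p : H × H)‖ ≤ _
    rw [Prod.norm_def]
    apply max_le <;> nlinarith [norm_nonneg (f p)]
  have : CompleteSpace A.graph := hA.isClosed_graph.completeSpace_coe
  have hclosed : IsClosed (LinearMap.range f.toLinearMap : Set H) :=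
    hanti.isClosed_range f.uniformContinuous
  have : CompleteSpace (LinearMap.range f.toLinearMap) := hclosed.completeSpace_coe
  have htop : LinearMap.range f.toLinearMap = ⊤ := by
    rw [← Submodule.orthogonal_eq_bot_iff, Submodule.eq_bot_iff]
    intro z hz
    have h1 : ∀ x : A.domain, inner ℂ z ((l : ℂ) • (x : H) - A x) = 0 := fun x =>
      Submodule.inner_left_of_mem_orthogonal (K := LinearMap.range f.toLinearMap)
        ⟨⟨_, A.mem_graph x⟩, rfl⟩ hz
    have h2 : (z, -((l : ℂ) • z)) ∈ A.graph := by
      rw [hA.mem_graph_iff]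
      intro x
      have := h1 x
      rw [inner_sub_right, inner_smul_right] at this
      rw [inner_neg_left, inner_smul_left, Complex.conj_ofReal]
      linear_combination -this
    have h3 := re_inner_eq_zero_of_skew (hskew _ h2 _ h2)
    rw [inner_neg_right, inner_smul_right, inner_self_eq_norm_sq_to_K] at h3
    have h4 : l * ‖z‖ ^ 2 = 0 := by
      simpa [← Complex.ofReal_pow] using h3
    simpa [hl] using h4
  obtain ⟨p, hp⟩ := LinearMap.range_eq_top.1 htop y
  refine ⟨(p : H × H).1, ?_⟩
  rw [← hp]
  change ((p : H × H).1, (l : ℂ) • (p : H × H).1 - ((l : ℂ) • (p : H × H).1 - (p : H × H).2)) ∈ _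
  rw [sub_sub_cancel]
  exact p.2

namespace AdmissiblePair

variable {A B : H →ₗ.[ℂ] H} {a : ℝ} (hAB : AdmissiblePair A B a 0)
include hAB

theorem norm_apply_le (x : A.domain) : ‖B ⟨x, hAB.domain_le x.2⟩‖ ≤ a * ‖A x‖ := by
  simpa using hAB.relBound x

/-- By the Pythagorean identity `‖A R(l)y‖ ≤ ‖y‖`, so `B R(l)` is bounded by `a`, whatever `l`. -/
theorem exists_comp_resolvent {l : ℝ} (hl : l ≠ 0) : ∃ T : H →L[ℂ] H, ‖T‖ ≤ a ∧
    ∀ y, ∃ hx : resolventAt A.graph l y ∈ A.domain,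
      A ⟨_, hx⟩ = (l : ℂ) • resolventAt A.graph l y - y ∧ B ⟨_, hAB.domain_le hx⟩ = T y := by
  have hG := hAB.skewAdjoint.isMaxSkew
  have hmem : ∀ y, resolventAt A.graph l y ∈ A.domain := fun y =>
    LinearPMap.mem_domain_of_mem_graph (hG.resolventAt_mem hl y)
  have hA : ∀ y, A ⟨_, hmem y⟩ = (l : ℂ) • resolventAt A.graph l y - y := fun y =>
    LinearPMap.mem_graph_snd_inj A (A.mem_graph ⟨_, hmem y⟩) (hG.resolventAt_mem hl y) rfl
  let T : H →ₗ[ℂ] H := B.toFun ∘ₗ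
    ((resolventAt A.graph l).toLinearMap.codRestrict B.domain fun y => hAB.domain_le (hmem y))
  have hT : ∀ y, ‖T y‖ ≤ a * ‖y‖ := by
    intro y
    refine (hAB.norm_apply_le ⟨_, hmem y⟩).trans ?_
    refine mul_le_mul_of_nonneg_left ?_ hAB.a_nonneg
    have h1 := norm_sq_smul_sub_of_re_inner_eq_zero (hG.re_inner (hG.resolventAt_mem hl y)) l
    rw [sub_sub_cancel] at h1
    rw [hA]
    refine abs_le_of_sq_le_sq' ?_ (norm_nonneg _) |>.2
    rw [h1]
    linarith [mul_nonneg (sq_nonneg l) (sq_nonneg ‖resolventAt A.graph l y‖)]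
  exact ⟨T.mkContinuous a hT, T.mkContinuous_norm_le hAB.a_nonneg hT,
    fun y => ⟨hmem y, hA y, rfl⟩⟩

/-- **Kato-Rellich theorem**: `A + c B` is maximal skew-symmetric for `|c| a < 1`. -/
theorem isMaxSkew_add_smul {c : ℝ} (hc : |c| * a < 1) :
    IsMaxSkew (A + (c : ℂ) • B).graph := by
  have hG := hAB.skewAdjoint.isMaxSkew
  refine ⟨?_, ?_, ?_⟩
  · refine hAB.skewAdjoint.1.mono fun x hx => ⟨_, (mem_graph_add_smul hAB.domain_le).2 ⟨hx, rfl⟩⟩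
  · rintro ⟨x, y⟩ hp ⟨z, w⟩ hq
    obtain ⟨hx, rfl⟩ := (mem_graph_add_smul hAB.domain_le).1 hp
    obtain ⟨hz, rfl⟩ := (mem_graph_add_smul hAB.domain_le).1 hq
    have h1 := hG.skew _ (A.mem_graph ⟨x, hx⟩) _ (A.mem_graph ⟨z, hz⟩)
    have h2 := hAB.skewSymmetric ⟨x, hAB.domain_le hx⟩ ⟨z, hAB.domain_le hz⟩
    simp only [inner_add_left, inner_add_right, inner_smul_left, inner_smul_right,
      Complex.conj_ofReal] at h1 h2 ⊢
    rw [h1, h2]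
    ring
  · intro l hl y
    obtain ⟨T, hT, hTB⟩ := hAB.exists_comp_resolvent hl
    have h1 : ‖(c : ℂ) • T‖ < 1 := by
      refine lt_of_le_of_lt ?_ hc
      rw [norm_smul, Complex.norm_real, Real.norm_eq_abs]
      gcongr
    -- Neumann series for the factorization `l - A - cB = (1 - cBR(l))(l - A)`; a right inverse
    -- suffices for surjectivity.
    obtain ⟨V, hV⟩ := (isUnit_one_sub_of_norm_lt_one h1).exists_right_inv
    have hz : V y - (c : ℂ) • T (V y) = y := by
      have := congrArg (fun W : H →L[ℂ] H => W y) hV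
      simpa using this
    refine ⟨resolventAt A.graph l (V y), (mem_graph_add_smul hAB.domain_le).2 ?_⟩
    obtain ⟨hx, hA, hB⟩ := hTB (V y)
    refine ⟨hx, ?_⟩
    rw [hA, hB, sub_add, hz]

theorem existsUnique_unitaryGroup {c : ℝ} (hc : |c| * a < 1) :
    ∃! U : ℝ → H →L[ℂ] H, IsUnitaryGroup U ∧ IsGenerator (A + (c : ℂ) • B) U := by
  obtain ⟨U, hU, hS⟩ := (hAB.isMaxSkew_add_smul hc).exists_isUnitaryGroup
  refine ⟨U, ⟨hU, hS⟩, fun W hW => hW.1.eq_of_isGenerator hU ?_ hW.2 hS⟩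
  rw [domain_add_smul hAB.domain_le]
  exact hAB.skewAdjoint.1

theorem unitaryExp_spec {c : ℝ} (hc : |c| * a < 1) :
    IsUnitaryGroup (unitaryExp (A + (c : ℂ) • B)) ∧
      IsGenerator (A + (c : ℂ) • B) (unitaryExp (A + (c : ℂ) • B)) := by
  have h := (hAB.existsUnique_unitaryGroup hc).exists
  have h1 : unitaryExp (A + (c : ℂ) • B) = h.choose := by
    ext1 t
    rw [unitaryExp, dif_pos h]
  rw [h1]
  exact h.choose_spec

end AdmissiblePair

end Perturbation

end BilinearControl

namespace BilinearControl

/-! ### Products of exponentials and the a priori bound in `D(A)` -/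

section Trajectories

variable {H : Type*} [NormedAddCommGroup H] [InnerProductSpace ℂ H] [CompleteSpace H]

/-- The product `e^{τ_(k-1) (A + c_(k-1) B)} ⋯ e^{τ_0 (A + c_0 B)}`. -/
noncomputable def expChain (A B : H →ₗ.[ℂ] H) (c τ : ℕ → ℝ) : ℕ → H →L[ℂ] H
  | 0 => 1
  | k + 1 => unitaryExp (A + (c k : ℂ) • B) (τ k) * expChain A B c τ k

theorem expChain_congr {A B : H →ₗ.[ℂ] H} {c τ σ : ℕ → ℝ} {k : ℕ} (h : ∀ i < k, τ i = σ i) :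
    expChain A B c τ k = expChain A B c σ k := by
  induction k with
  | zero => rfl
  | succ k ih =>
    rw [expChain, expChain, h k k.lt_succ_self, ih fun i hi => h i (hi.trans k.lt_succ_self)]

/-- Separating values from durations allows a chain to be stopped at time `r` by truncating the
durations, with the values fixed. -/
theorem concatenation_eq_expChain (A B : H →ₗ.[ℂ] H) (v : ℝ → ℝ) (s : ℕ → ℝ) (k : ℕ) :
    concatenation A B v s k =
      expChain A B (fun k => v ((s k + s (k + 1)) / 2)) (fun k => s (k + 1) - s k) k := by
  induction k with
  | zero => rfl
  | succ k ih => rw [expChain, concatenation, ih]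

theorem IsUnitaryGroup.continuous_apply {U : ℝ → H →L[ℂ] H} (hU : IsUnitaryGroup U) {f : ℝ → ℝ}
    {g : ℝ → H} (hf : Continuous f) (hg : Continuous g) : Continuous fun r => U (f r) (g r) := by
  rw [continuous_iff_continuousAt]
  intro r
  have h1 : Tendsto (fun s => U (f s) (g s - g r)) (𝓝 r) (𝓝 0) := by
    rw [tendsto_zero_iff_norm_tendsto_zero]
    simp only [hU.norm_apply]
    exact tendsto_iff_norm_sub_tendsto_zero.1 (hg.tendsto r)
  have h2 := ((hU.continuous_orbit (g r)).comp hf).tendsto r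
  simpa [ContinuousAt] using h1.add h2

namespace AdmissiblePair

variable {A B : H →ₗ.[ℂ] H} {a δ : ℝ} (hAB : AdmissiblePair A B a 0)
include hAB

theorem norm_expChain_apply {c : ℕ → ℝ} (hc : ∀ k, |c k| * a < 1) (τ : ℕ → ℝ) (k : ℕ) (x : H) :
    ‖expChain A B c τ k x‖ = ‖x‖ := by
  induction k with
  | zero => rfl
  | succ k ih =>
    rw [expChain, mul_apply_eq_comp, (hAB.unitaryExp_spec (hc k)).1.norm_apply, ih]

/-- The margin `δ` makes `‖Ax‖` comparable to `‖(A + cB)x‖` uniformly in `c`. -/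
theorem mul_norm_le_norm_add {c : ℝ} (hc : |c| * a ≤ 1 - δ) (x : A.domain) :
    δ * ‖A x‖ ≤ ‖A x + (c : ℂ) • B ⟨x, hAB.domain_le x.2⟩‖ := by
  have h1 := norm_sub_le (A x + (c : ℂ) • B ⟨x, hAB.domain_le x.2⟩)
    ((c : ℂ) • B ⟨x, hAB.domain_le x.2⟩)
  rw [add_sub_cancel_right, norm_smul, Complex.norm_real, Real.norm_eq_abs] at h1
  have h2 := mul_le_mul_of_nonneg_left (hAB.norm_apply_le x) (abs_nonneg c)
  nlinarith [norm_nonneg (A x)]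

/-- Each group commutes with its generator, so `‖(A + c_k B)x‖` changes only at switches. There the
change is at most `|Δ|‖Bx‖ ≤ (a/δ)|Δ|‖(A + c_k B)x‖`, a Gronwall-type product over the jumps. -/
theorem exists_expChain_bound (hδ : 0 < δ) {c : ℕ → ℝ} (hc : ∀ k, |c k| * a ≤ 1 - δ)
    (τ : ℕ → ℝ) {x y : H} (hxy : (x, y) ∈ (A + (c 0 : ℂ) • B).graph) (k : ℕ) :
    ∃ z, (expChain A B c τ (k + 1) x, z) ∈ (A + (c k : ℂ) • B).graph ∧
      ‖z‖ ≤ Real.exp (a / δ * ∑ j ∈ Finset.range k, |c (j + 1) - c j|) * ‖y‖ := by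
  have hc' : ∀ k, |c k| * a < 1 := fun k => (hc k).trans_lt (by linarith)
  induction k with
  | zero =>
    obtain ⟨hU, hS⟩ := hAB.unitaryExp_spec (hc' 0)
    exact ⟨_, hS.map_mem hU hxy (τ 0), by simp [hU.norm_apply]⟩
  | succ k ih =>
    obtain ⟨z, hz, hzy⟩ := ih
    obtain ⟨hU, hS⟩ := hAB.unitaryExp_spec (hc' (k + 1))
    obtain ⟨hw, rfl⟩ := (mem_graph_add_smul hAB.domain_le).1 hz
    set w : A.domain := ⟨_, hw⟩
    have h1 := (mem_graph_add_smul (c := (c (k + 1) : ℂ)) hAB.domain_le).2 ⟨hw, rfl⟩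
    refine ⟨_, hS.map_mem hU h1 (τ (k + 1)), ?_⟩
    rw [hU.norm_apply, Finset.sum_range_succ, mul_add, Real.exp_add]
    change ‖A w + (c k : ℂ) • B ⟨w, hAB.domain_le w.2⟩‖ ≤ _ at hzy
    change ‖A w + (c (k + 1) : ℂ) • B ⟨w, hAB.domain_le w.2⟩‖ ≤ _
    set b := B ⟨w, hAB.domain_le w.2⟩ with hb
    have h2 : A w + (c (k + 1) : ℂ) • b =
        (A w + (c k : ℂ) • b) + ((c (k + 1) - c k : ℝ) : ℂ) • b := by
      push_cast
      module
    have h3 : ‖b‖ ≤ a * ‖A w‖ := hAB.norm_apply_le w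
    have h4 : δ * ‖A w‖ ≤ ‖A w + (c k : ℂ) • b‖ := hAB.mul_norm_le_norm_add (hc k) w
    have h5 : ‖b‖ ≤ a / δ * ‖A w + (c k : ℂ) • b‖ := by
      refine h3.trans ?_
      rw [div_mul_eq_mul_div, le_div_iff₀ hδ]
      nlinarith [mul_le_mul_of_nonneg_left h4 hAB.a_nonneg]
    have h6 : ‖A w + (c (k + 1) : ℂ) • b‖ ≤
        (1 + a / δ * |c (k + 1) - c k|) * ‖A w + (c k : ℂ) • b‖ := by
      rw [h2]
      refine (norm_add_le _ _).trans ?_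
      rw [norm_smul, Complex.norm_real, Real.norm_eq_abs]
      nlinarith [mul_le_mul_of_nonneg_left h5 (abs_nonneg (c (k + 1) - c k))]
    have h7 := Real.add_one_le_exp (a / δ * |c (k + 1) - c k|)
    refine h6.trans ?_
    calc (1 + a / δ * |c (k + 1) - c k|) * ‖A w + (c k : ℂ) • b‖
        ≤ Real.exp (a / δ * |c (k + 1) - c k|) * ‖A w + (c k : ℂ) • b‖ := by
          gcongr; linarith
      _ ≤ Real.exp (a / δ * |c (k + 1) - c k|) *
          (Real.exp (a / δ * ∑ j ∈ Finset.range k, |c (j + 1) - c j|) * ‖y‖) := by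
          gcongr
      _ = _ := by ring

/-- The factor `2` passes from `A` to `A + c_0 B` at the start and `1/δ` passes back at the end. A
chain of `k` factors has `k - 1` jumps; the truncated subtraction also covers the empty chain. -/
theorem norm_expChain_le (hδ : δ ∈ Ioo (0 : ℝ) 1) {c : ℕ → ℝ} (hc : ∀ k, |c k| * a ≤ 1 - δ)
    (τ : ℕ → ℝ) (x : A.domain) {k : ℕ} {V : ℝ}
    (hV : ∑ j ∈ Finset.range (k - 1), |c (j + 1) - c j| ≤ V) :
    ∃ h : expChain A B c τ k x ∈ A.domain,
      ‖A ⟨_, h⟩‖ ≤ 2 / δ * Real.exp (a / δ * V) * ‖A x‖ := by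
  have hV0 : 0 ≤ V := le_trans (Finset.sum_nonneg fun _ _ => abs_nonneg _) hV
  have haδ : 0 ≤ a / δ := div_nonneg hAB.a_nonneg hδ.1.le
  have hexp : 1 ≤ Real.exp (a / δ * V) := Real.one_le_exp (mul_nonneg haδ hV0)
  rcases k with _ | k
  · refine ⟨x.2, ?_⟩
    change ‖A x‖ ≤ _
    have h1 : 1 ≤ 2 / δ := by rw [le_div_iff₀ hδ.1]; linarith [hδ.2]
    have h2 : 1 ≤ 2 / δ * Real.exp (a / δ * V) := by nlinarith
    nlinarith [norm_nonneg (A x)]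
  · have h1 := (mem_graph_add_smul (c := (c 0 : ℂ)) hAB.domain_le).2 ⟨x.2, rfl⟩
    obtain ⟨z, hz, hzy⟩ := hAB.exists_expChain_bound hδ.1 hc τ h1 k
    obtain ⟨hw, rfl⟩ := (mem_graph_add_smul hAB.domain_le).1 hz
    refine ⟨hw, ?_⟩
    have h2 := hAB.mul_norm_le_norm_add (hc k) ⟨_, hw⟩
    have h3 : ‖A x + (c 0 : ℂ) • B ⟨x, hAB.domain_le x.2⟩‖ ≤ 2 * ‖A x‖ := by
      refine (norm_add_le _ _).trans ?_
      rw [norm_smul, Complex.norm_real, Real.norm_eq_abs]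
      have h4 := mul_le_mul_of_nonneg_left (hAB.norm_apply_le x) (abs_nonneg (c 0))
      have h5 : |c 0| * a * ‖A x‖ ≤ 1 * ‖A x‖ := by
        gcongr; linarith [hc 0, hδ.1]
      linarith
    have h6 : Real.exp (a / δ * ∑ j ∈ Finset.range k, |c (j + 1) - c j|) ≤
        Real.exp (a / δ * V) := by gcongr; exact hV
    have h7 : δ * ‖A ⟨_, hw⟩‖ ≤ Real.exp (a / δ * V) * (2 * ‖A x‖) :=
      (h2.trans hzy).trans (mul_le_mul h6 h3 (norm_nonneg _) (Real.exp_pos _).le)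
    rw [div_mul_eq_mul_div, div_mul_eq_mul_div, le_div_iff₀ hδ.1]
    linarith

theorem continuous_expChain {c : ℕ → ℝ} (hc : ∀ k, |c k| * a < 1) {τ : ℝ → ℕ → ℝ}
    (hτ : ∀ k, Continuous fun r => τ r k) (k : ℕ) (x : H) :
    Continuous fun r => expChain A B c (τ r) k x := by
  induction k with
  | zero => exact continuous_const
  | succ k ih =>
    exact (hAB.unitaryExp_spec (hc k)).1.continuous_apply (hτ k) ih

/-- At time `r` in the `j`-th interval the truncated durations are complete before `j`, equal `r - s
j` at `j`, and vanish afterwards; only the `j`-th exponential moves. -/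
theorem hasDerivAt_expChain {c : ℕ → ℝ} (hc : ∀ k, |c k| * a < 1) {s : ℕ → ℝ} {p : ℕ}
    (hs : MonotoneOn s (Iic p)) {x : H}
    (hdom : ∀ τ k, expChain A B c τ k x ∈ A.domain) {k j : ℕ} (hk : k ≤ p) (hj : j < k) {r : ℝ}
    (hr : r ∈ Ioo (s j) (s (j + 1))) :
    ∃ y, HasDerivAt
        (fun r => expChain A B c (fun i => min r (s (i + 1)) - min r (s i)) k x) y r ∧
      (expChain A B c (fun i => min r (s (i + 1)) - min r (s i)) k x, y) ∈
        (A + (c j : ℂ) • B).graph := by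
  induction k with
  | zero => exact absurd hj (Nat.not_lt_zero _)
  | succ k ih =>
    obtain ⟨hU, hS⟩ := hAB.unitaryExp_spec (hc k)
    rcases Nat.lt_succ_iff_lt_or_eq.1 hj with hjk | rfl
    · obtain ⟨y, hy, hg⟩ := ih (by omega) hjk
      have h1 : s (j + 1) ≤ s k := hs (mem_Iic.2 (by omega)) (mem_Iic.2 (by omega)) (by omega)
      have h2 : s k ≤ s (k + 1) := hs (mem_Iic.2 (by omega)) (mem_Iic.2 (by omega)) (by omega)
      have h3 : ∀ q < s k, expChain A B c (fun i => min q (s (i + 1)) - min q (s i)) (k + 1) x =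
          expChain A B c (fun i => min q (s (i + 1)) - min q (s i)) k x := by
        intro q hq
        rw [expChain, mul_apply_eq_comp, min_eq_left (hq.le.trans h2), min_eq_left hq.le, sub_self,
          hU.map_zero_apply]
      have h4 : r < s k := hr.2.trans_le h1
      refine ⟨y, hy.congr_of_eventuallyEq ?_, ?_⟩
      · filter_upwards [Iio_mem_nhds h4] with q hq using h3 q hq
      · rwa [h3 r h4]
    · have h3 : ∀ q ∈ Ioo (s j) (s (j + 1)),
          expChain A B c (fun i => min q (s (i + 1)) - min q (s i)) (j + 1) x =
          unitaryExp (A + (c j : ℂ) • B) (q - s j)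
            (expChain A B c (fun i => s (i + 1) - s i) j x) := by
        intro q hq
        rw [expChain, mul_apply_eq_comp, min_eq_left hq.2.le, min_eq_right hq.1.le]
        congr 2
        refine expChain_congr fun i hi => ?_
        have h1 : s (i + 1) ≤ s j := hs (mem_Iic.2 (by omega)) (mem_Iic.2 (by omega)) (by omega)
        have h2 : s i ≤ s j := hs (mem_Iic.2 (by omega)) (mem_Iic.2 (by omega)) (by omega)
        rw [min_eq_right (h1.trans hq.1.le), min_eq_right (h2.trans hq.1.le)]
      set w := expChain A B c (fun i => s (i + 1) - s i) j x
      have h4 := (mem_graph_add_smul (c := (c j : ℂ)) hAB.domain_le).2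
        ⟨hdom (fun i => s (i + 1) - s i) j, rfl⟩
      refine ⟨_, ((hU.hasDerivAt_apply ((hS _ _).1 h4) (r - s j)).comp_sub_const
        r (s j)).congr_of_eventuallyEq ?_, ?_⟩
      · filter_upwards [Ioo_mem_nhds hr.1 hr.2] with q hq using h3 q hq
      · rw [h3 r hr]
        exact hS.map_mem hU h4 _

end AdmissiblePair

end Trajectories

end BilinearControl

namespace BilinearControl

/-! ### Trajectories of piecewise constant controls and their `L¹` comparison -/

section Comparison

variable {H : Type*} [NormedAddCommGroup H] [InnerProductSpace ℂ H] [CompleteSpace H]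

theorem IsSwitchingPartition.monotoneOn {v : ℝ → ℝ} {t : ℝ} {p : ℕ} {s : ℕ → ℝ}
    (h : IsSwitchingPartition v t p s) : MonotoneOn s (Iic p) := by
  intro i _ j hj hij
  rw [mem_Iic] at hj
  induction j, hij using Nat.le_induction with
  | base => exact le_rfl
  | succ j hij ih => exact (ih (by omega)).trans (h.lt_succ j (by omega)).le

theorem IsSwitchingPartition.exists_mem_Ioo {v : ℝ → ℝ} {t : ℝ} {p : ℕ} {s : ℕ → ℝ}
    (h : IsSwitchingPartition v t p s) {r : ℝ} (hr : r ∈ Ioo 0 t) (hrs : r ∉ s '' Iic p) :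
    ∃ j < p, r ∈ Ioo (s j) (s (j + 1)) := by
  by_contra! hcon
  have h1 : ∀ k ≤ p, s k < r := by
    intro k
    induction k with
    | zero => intro _; rw [h.start]; exact hr.1
    | succ k ih =>
      intro hk
      have h2 := ih (by omega)
      by_contra! h3
      rcases h3.lt_or_eq with h4 | h4
      · exact hcon k (by omega) ⟨h2, h4⟩
      · exact hrs ⟨k + 1, hk, h4.symm⟩
  have h5 := h1 p le_rfl
  rw [h.finish] at h5
  exact absurd hr.2 (not_lt.2 h5.le)

/-- Midpoints form a monotone sample of `[0,t]`, so the jumps of the chain are bounded by the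
variation. -/
theorem sum_abs_sub_midpoint_le {v : ℝ → ℝ} {t : ℝ} {p : ℕ} {s : ℕ → ℝ}
    (h : IsSwitchingPartition v t p s) {V : ℝ} (hV0 : 0 ≤ V)
    (hV : eVariationOn v (Icc 0 t) ≤ ENNReal.ofReal V) :
    ∑ j ∈ Finset.range (p - 1),
      |v ((s (j + 1) + s (j + 1 + 1)) / 2) - v ((s j + s (j + 1)) / 2)| ≤ V := by
  rcases p with _ | p
  · simpa using hV0
  have hs := h.monotoneOn
  have hm : ∀ i j, i ≤ j → j ≤ p + 1 → s i ≤ s j := fun i j hij hj =>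
    hs (mem_Iic.2 (by omega)) (mem_Iic.2 hj) hij
  have h1 : MonotoneOn (fun j => (s j + s (j + 1)) / 2) (Iic p) := by
    intro i _ j hj hij
    rw [mem_Iic] at hj
    have h2 := hm i j hij (by omega)
    have h3 := hm (i + 1) (j + 1) (by omega) (by omega)
    simp only
    linarith
  have h2 := (eVariationOn.sum_le_of_monotoneOn_Iic (f := v) (s := Icc 0 t) h1 (fun i hi => by
    have h3 := hm 0 i (by omega) (by omega)
    have h4 := hm 0 (i + 1) (by omega) (by omega)
    have h5 := hm i (p + 1) (by omega) (by omega)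
    have h6 := hm (i + 1) (p + 1) (by omega) (by omega)
    rw [h.start] at h3 h4
    rw [h.finish] at h5 h6
    constructor <;> linarith)).trans hV
  simp only [edist_dist, Real.dist_eq] at h2
  rw [← ENNReal.ofReal_sum_of_nonneg (fun _ _ => abs_nonneg _)] at h2
  exact (ENNReal.ofReal_le_ofReal_iff hV0).1 h2

/-- `x` is a trajectory on `[0,t]` of `x' = (A + v B) x` starting at `ψ`, up to countably many
times, with norm `‖ψ‖` and with `‖B x‖ ≤ M`. -/
structure IsTrajectory (A B : H →ₗ.[ℂ] H) (v : ℝ → ℝ) (t : ℝ) (ψ : H) (M : ℝ) (x : ℝ → H) :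
    Prop where
  continuous : Continuous x
  map_zero : x 0 = ψ
  norm_eq : ∀ r, ‖x r‖ = ‖ψ‖
  bound : ∀ r, x r ∈ A.domain ∧ ∃ b, (x r, b) ∈ B.graph ∧ ‖b‖ ≤ M
  hasDerivAt : ∃ F : Set ℝ, F.Countable ∧ ∀ r ∈ Ioo 0 t \ F,
    ∃ y, HasDerivAt x y r ∧ (x r, y) ∈ (A + (v r : ℂ) • B).graph

namespace AdmissiblePair

variable {A B : H →ₗ.[ℂ] H} {a δ : ℝ} (hAB : AdmissiblePair A B a 0)
include hAB

theorem exists_isTrajectory (hδ : δ ∈ Ioo (0 : ℝ) 1) {v : ℝ → ℝ} (hv : ∀ r, |v r| * a ≤ 1 - δ)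
    {t : ℝ} {p : ℕ} {s : ℕ → ℝ} (h : IsSwitchingPartition v t p s) {V : ℝ} (hV0 : 0 ≤ V)
    (hV : eVariationOn v (Icc 0 t) ≤ ENNReal.ofReal V) (ψ : A.domain) :
    ∃ x, IsTrajectory A B v t ψ (a * (2 / δ * Real.exp (a / δ * V) * ‖A ψ‖)) x ∧
      x t = concatenation A B v s p ψ := by
  set c : ℕ → ℝ := fun k => v ((s k + s (k + 1)) / 2) with hc
  have hc1 : ∀ k, |c k| * a ≤ 1 - δ := fun k => hv _
  have hc2 : ∀ k, |c k| * a < 1 := fun k => (hc1 k).trans_lt (by linarith [hδ.1])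
  have hdom : ∀ τ k, expChain A B c τ k ψ ∈ A.domain := fun τ k =>
    (hAB.norm_expChain_le hδ hc1 τ ψ le_rfl).1
  have hs := h.monotoneOn
  have hs0 : ∀ k ≤ p, 0 ≤ s k := fun k hk => by
    rw [← h.start]; exact hs (mem_Iic.2 (Nat.zero_le _)) (mem_Iic.2 hk) (Nat.zero_le _)
  have hst : ∀ k ≤ p, s k ≤ t := fun k hk => by
    rw [← h.finish]; exact hs (mem_Iic.2 hk) (mem_Iic.2 le_rfl) hk
  refine ⟨fun r => expChain A B c (fun i => min r (s (i + 1)) - min r (s i)) p ψ,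
    ⟨?_, ?_, ?_, ?_, ?_⟩, ?_⟩
  · exact hAB.continuous_expChain hc2 (fun k => by fun_prop) p ψ
  · have : ∀ k ≤ p, expChain A B c (fun i => min 0 (s (i + 1)) - min 0 (s i)) k ψ = (ψ : H) := by
      intro k
      induction k with
      | zero => intro _; rfl
      | succ k ih =>
        intro hk
        rw [expChain, mul_apply_eq_comp, ih (by omega), min_eq_left (hs0 _ hk),
          min_eq_left (hs0 k (by omega)), sub_self,
          (hAB.unitaryExp_spec (hc2 k)).1.map_zero_apply]
    exact this p le_rfl
  · exact fun r => hAB.norm_expChain_apply hc2 _ p ψ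
  · intro r
    obtain ⟨h1, h2⟩ := hAB.norm_expChain_le hδ hc1
      (fun i => min r (s (i + 1)) - min r (s i)) ψ (sum_abs_sub_midpoint_le h hV0 hV)
    exact ⟨h1, _, B.mem_graph ⟨_, hAB.domain_le h1⟩,
      (hAB.norm_apply_le ⟨_, h1⟩).trans (mul_le_mul_of_nonneg_left h2 hAB.a_nonneg)⟩
  · refine ⟨s '' Iic p, ((finite_Iic p).image s).countable, fun r hr => ?_⟩
    obtain ⟨j, hj, hrj⟩ := h.exists_mem_Ioo hr.1 hr.2
    obtain ⟨d, hd⟩ := h.const j hj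
    have h1 : v r = c j := by
      rw [hd r hrj]
      have h2 := h.lt_succ j hj
      exact (hd _ ⟨by linarith, by linarith⟩).symm
    rw [h1]
    exact hAB.hasDerivAt_expChain hc2 hs hdom le_rfl hj hrj
  · rw [concatenation_eq_expChain]
    simp only
    congr 1
    refine expChain_congr fun i hi => ?_
    rw [min_eq_right (hst _ hi), min_eq_right (hst i (by omega))]

theorem norm_sub_sq_le_integral {v w : ℝ → ℝ} (hw : ∀ r, |w r| * a < 1)
    {t : ℝ} (ht : 0 ≤ t) {ψ : H} {M : ℝ} {x y : ℝ → H} (hx : IsTrajectory A B v t ψ M x)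
    (hy : IsTrajectory A B w t ψ M y)
    (hvw : IntervalIntegrable (fun r => |v r - w r|) MeasureTheory.volume 0 t) :
    ‖x t - y t‖ ^ 2 ≤ 4 * ‖ψ‖ * M * ∫ r in (0 : ℝ)..t, |v r - w r| := by
  let _ : InnerProductSpace ℝ H := InnerProductSpace.rclikeToReal ℂ H
  obtain ⟨F, hF, hFx⟩ := hx.hasDerivAt
  obtain ⟨F', hF', hFy⟩ := hy.hasDerivAt
  set g : ℝ → ℝ := fun r => ‖x r - y r‖ ^ 2 with hg
  have hM : 0 ≤ M := by
    obtain ⟨-, b, -, hb⟩ := hx.bound 0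
    exact (norm_nonneg b).trans hb
  have hder : ∀ r ∈ Ioo 0 t \ (F ∪ F'), DifferentiableAt ℝ g r ∧
      |deriv g r| ≤ 4 * ‖ψ‖ * M * |v r - w r| := by
    intro r hr
    obtain ⟨x', hx', hxg⟩ := hFx r ⟨hr.1, fun h => hr.2 (Or.inl h)⟩
    obtain ⟨y', hy', hyg⟩ := hFy r ⟨hr.1, fun h => hr.2 (Or.inr h)⟩
    have h1 := (hx'.sub hy').norm_sq
    simp only [Pi.sub_apply] at h1
    refine ⟨h1.differentiableAt, ?_⟩
    have h2 : deriv g r = 2 * inner ℝ (x r - y r) (x' - y') := h1.deriv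
    obtain ⟨hxA, b, hb, hbM⟩ := hx.bound r
    obtain ⟨hxA', rfl⟩ := (mem_graph_add_smul hAB.domain_le).1 hxg
    have hb' : B ⟨x r, hAB.domain_le hxA⟩ = b :=
      LinearPMap.mem_graph_snd_inj B (B.mem_graph ⟨x r, hAB.domain_le hxA⟩) hb rfl
    rw [hb'] at h2
    have hxw := (mem_graph_add_smul (c := (w r : ℂ)) hAB.domain_le).2 ⟨hxA, rfl⟩
    rw [hb'] at hxw
    have h3 := (hAB.isMaxSkew_add_smul (hw r)).re_inner (Submodule.sub_mem _ hxw hyg)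
    -- This is `x' - y' = (A + wB)(x - y) + (v - w)Bx`; the first summand has zero real inner
    -- product with `x - y`.
    have h4 : A ⟨x r, hxA'⟩ + (v r : ℂ) • b - y' =
        (A ⟨x r, hxA⟩ + (w r : ℂ) • b - y') + ((v r - w r : ℝ) : ℂ) • b := by
      push_cast
      module
    have h5 : inner ℝ (x r - y r) (A ⟨x r, hxA'⟩ + (v r : ℂ) • b - y') =
        (inner ℂ (x r - y r) (((v r - w r : ℝ) : ℂ) • b)).re := by
      change (inner ℂ (x r - y r) (A ⟨x r, hxA'⟩ + (v r : ℂ) • b - y')).re = _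
      rw [h4, inner_add_right, Complex.add_re]
      change (inner ℂ (x r - y r) (A ⟨x r, hxA⟩ + (w r : ℂ) • b - y')).re + _ = _
      have h3' : (inner ℂ (x r - y r) (A ⟨x r, hxA⟩ + (w r : ℂ) • b - y')).re = 0 := h3
      rw [h3', zero_add]
    rw [h2, h5, abs_mul, abs_two]
    have h6 : |(inner ℂ (x r - y r) (((v r - w r : ℝ) : ℂ) • b)).re| ≤
        ‖x r - y r‖ * (|v r - w r| * ‖b‖) := by
      refine (Complex.abs_re_le_norm _).trans ((norm_inner_le_norm _ _).trans_eq ?_)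
      rw [norm_smul, Complex.norm_real, Real.norm_eq_abs]
    have h7 : ‖x r - y r‖ ≤ 2 * ‖ψ‖ := by
      refine (norm_sub_le _ _).trans ?_
      rw [hx.norm_eq, hy.norm_eq]
      linarith
    have h8 : ‖x r - y r‖ * (|v r - w r| * ‖b‖) ≤ (2 * ‖ψ‖) * (|v r - w r| * M) := by
      gcongr
    linarith
  have hFF : (F ∪ F').Countable := hF.union hF'
  have hae : ∀ᵐ r ∂(MeasureTheory.volume.restrict (Ioc 0 t)),
      ‖deriv g r‖ ≤ 4 * ‖ψ‖ * M * |v r - w r| := by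
    rw [MeasureTheory.ae_restrict_iff' measurableSet_Ioc]
    have h1 : ∀ᵐ r : ℝ, r ∉ F ∪ F' ∪ {t} :=
      (hFF.union (countable_singleton t)).ae_notMem MeasureTheory.volume
    filter_upwards [h1] with r hr hrt
    have hrt' : r ≠ t := fun h => hr (Or.inr h)
    exact (hder r ⟨⟨hrt.1, lt_of_le_of_ne hrt.2 hrt'⟩, fun h => hr (Or.inl h)⟩).2
  have hint : IntervalIntegrable (fun r => 4 * ‖ψ‖ * M * |v r - w r|) MeasureTheory.volume 0 t :=
    hvw.const_mul _
  have hgint : IntervalIntegrable (deriv g) MeasureTheory.volume 0 t := by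
    rw [intervalIntegrable_iff_integrableOn_Ioc_of_le ht] at hint ⊢
    exact MeasureTheory.Integrable.mono' hint (measurable_deriv g).aestronglyMeasurable hae
  have hcont : Continuous g := ((hx.continuous.sub hy.continuous).norm).pow 2
  -- The switching times are countable and `g` is continuous, so the fundamental theorem of calculus
  -- needs the derivative only off them.
  have hFTC := MeasureTheory.integral_eq_of_hasDerivAt_off_countable_of_le g (deriv g) ht hFF
    hcont.continuousOn (fun r hr => (hder r hr).1.hasDerivAt) hgint
  have hg0 : g 0 = 0 := by simp [hg, hx.map_zero, hy.map_zero]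
  rw [hg0, sub_zero] at hFTC
  change g t ≤ _
  rw [← hFTC, ← intervalIntegral.integral_const_mul]
  refine intervalIntegral.integral_mono_ae_restrict ht hgint hint ?_
  rw [MeasureTheory.restrict_Ioc_eq_restrict_Icc.symm]
  filter_upwards [hae] with r hr using (le_abs_self _).trans hr

end AdmissiblePair

end Comparison

end BilinearControl

namespace BilinearControl

/-! ### Existence of approximating sequences -/

section StepApproximation

theorem exists_monotone_sub_of_boundedVariationOn {u : ℝ → ℝ} (hu : BoundedVariationOn u univ) :
    ∃ p q : ℝ → ℝ, Monotone p ∧ Monotone q ∧ u = p - q := by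
  obtain ⟨p, q, hp, hq, h⟩ := hu.locallyBoundedVariationOn.exists_monotoneOn_sub_monotoneOn
  exact ⟨p, q, monotoneOn_univ.1 hp, monotoneOn_univ.1 hq, h⟩

theorem measurable_of_boundedVariationOn {u : ℝ → ℝ} (hu : BoundedVariationOn u univ) :
    Measurable u := by
  obtain ⟨p, q, hp, hq, rfl⟩ := exists_monotone_sub_of_boundedVariationOn hu
  exact hp.measurable.sub hq.measurable

theorem countable_not_continuousAt_of_boundedVariationOn {u : ℝ → ℝ}
    (hu : BoundedVariationOn u univ) : {x | ¬ ContinuousAt u x}.Countable := by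
  obtain ⟨p, q, hp, hq, rfl⟩ := exists_monotone_sub_of_boundedVariationOn hu
  refine (hp.countable_not_continuousAt.union hq.countable_not_continuousAt).mono fun x hx => ?_
  by_contra h
  simp only [mem_union, mem_ofPred_eq, not_or, not_not] at h
  exact hx (h.1.sub h.2)

/-- The largest element of `{0} ∪ {d 0, …, d (n-1)}` among those not exceeding `t`
(and `0` for `t ≤ 0`). -/
noncomputable def stepTime (d : ℕ → ℝ) : ℕ → ℝ → ℝ
  | 0, _ => 0
  | n + 1, t => max (stepTime d n t) (if d n ≤ t then d n else 0)

theorem stepTime_nonneg (d : ℕ → ℝ) (n : ℕ) (t : ℝ) : 0 ≤ stepTime d n t := by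
  induction n with
  | zero => exact le_rfl
  | succ n ih => exact ih.trans (le_max_left _ _)

theorem stepTime_le (d : ℕ → ℝ) (n : ℕ) (t : ℝ) : stepTime d n t ≤ max t 0 := by
  induction n with
  | zero => exact le_max_right _ _
  | succ n ih =>
    refine max_le ih ?_
    split_ifs with h
    · exact h.trans (le_max_left _ _)
    · exact le_max_right _ _

theorem stepTime_monotone (d : ℕ → ℝ) (n : ℕ) : Monotone (stepTime d n) := by
  induction n with
  | zero => exact fun _ _ _ => le_rfl
  | succ n ih =>
    intro t t' htt
    refine max_le ((ih htt).trans (le_max_left _ _)) ?_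
    split_ifs with h
    · rw [stepTime, if_pos (h.trans htt)]
      exact le_max_right _ _
    · exact stepTime_nonneg d (n + 1) t'

theorem le_stepTime {d : ℕ → ℝ} {i n : ℕ} (hi : i < n) {t : ℝ} (h : d i ≤ t) :
    d i ≤ stepTime d n t := by
  induction n, hi using Nat.le_induction with
  | base => rw [stepTime, if_pos h]; exact le_max_right _ _
  | succ n _ ih => exact ih.trans (le_max_left _ _)

theorem stepTime_eq_of_forall_notMem {d : ℕ → ℝ} {n : ℕ} {x y : ℝ}
    (h : ∀ i < n, d i ∉ Ioo x y) {r r' : ℝ} (hr : r ∈ Ioo x y) (hr' : r' ∈ Ioo x y) :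
    stepTime d n r = stepTime d n r' := by
  induction n with
  | zero => rfl
  | succ n ih =>
    rw [stepTime, stepTime, ih fun i hi => h i (by omega)]
    have h1 : d n ≤ r ↔ d n ≤ r' := by
      rcases le_or_gt (d n) x with h2 | h2
      · exact ⟨fun _ => h2.trans hr'.1.le, fun _ => h2.trans hr.1.le⟩
      · have h3 : y ≤ d n := not_lt.1 fun h3 => h n (by omega) ⟨h2, h3⟩
        exact ⟨fun h4 => absurd (hr.2.trans_le h3) (not_lt.2 h4),
          fun h4 => absurd (hr'.2.trans_le h3) (not_lt.2 h4)⟩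
    simp only [h1]

theorem exists_partition_of_finset (F : Finset ℝ) {t : ℝ} (ht : 0 ≤ t) :
    ∃ (p : ℕ) (s : ℕ → ℝ), s 0 = 0 ∧ s p = t ∧ (∀ k < p, s k < s (k + 1)) ∧
      ∀ k < p, ∀ x ∈ F, x ∉ Ioo (s k) (s (k + 1)) := by
  set S : Finset ℝ := insert 0 (insert t (F.filter fun x => x ∈ Icc 0 t)) with hS
  have hSne : S.Nonempty := ⟨0, Finset.mem_insert_self _ _⟩
  obtain ⟨m, hm⟩ : ∃ m, S.card = m + 1 :=
    Nat.exists_eq_succ_of_ne_zero (Finset.card_pos.2 hSne).ne'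
  set e := S.orderEmbOfFin hm
  have hSI : ∀ x ∈ S, x ∈ Icc 0 t := by
    intro x hx
    simp only [hS, Finset.mem_insert, Finset.mem_filter] at hx
    rcases hx with rfl | rfl | hx
    · exact ⟨le_rfl, ht⟩
    · exact ⟨ht, le_rfl⟩
    · exact hx.2
  have hsurj : ∀ x ∈ S, ∃ i, e i = x := fun x hx => by
    have : x ∈ Set.range e := by rw [Finset.range_orderEmbOfFin]; exact hx
    exact this
  have hmem : ∀ i, e i ∈ S := fun i => S.orderEmbOfFin_mem hm i
  -- The index is clamped at `m`, since `s` must be defined on all of `ℕ`.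
  refine ⟨m, fun k => e ⟨min k m, by omega⟩, ?_, ?_, ?_, ?_⟩
  · obtain ⟨i, hi⟩ := hsurj 0 (Finset.mem_insert_self _ _)
    refine le_antisymm ?_ (hSI _ (hmem _)).1
    rw [← hi]
    exact e.monotone (Fin.le_def.2 (by simp))
  · obtain ⟨i, hi⟩ := hsurj t (Finset.mem_insert_of_mem (Finset.mem_insert_self _ _))
    refine le_antisymm (hSI _ (hmem _)).2 ?_
    rw [← hi]
    exact e.monotone (Fin.le_def.2 (by simp; omega))
  · intro k hk
    exact e.strictMono (Fin.lt_def.2 (by simp only; omega))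
  · intro k hk x hx hxk
    have h1 := (hSI _ (hmem ⟨min k m, by omega⟩)).1
    have h2 := (hSI _ (hmem ⟨min (k + 1) m, by omega⟩)).2
    have hxS : x ∈ S := Finset.mem_insert_of_mem (Finset.mem_insert_of_mem
      (Finset.mem_filter.2 ⟨hx, h1.trans hxk.1.le, hxk.2.le.trans h2⟩))
    obtain ⟨i, rfl⟩ := hsurj x hxS
    have h3 := Fin.lt_def.1 (e.lt_iff_lt.1 hxk.1)
    have h4 := Fin.lt_def.1 (e.lt_iff_lt.1 hxk.2)
    simp only at h3 h4
    omega

theorem isPiecewiseConstant_comp_stepTime (u : ℝ → ℝ) (d : ℕ → ℝ) (n : ℕ) :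
    IsPiecewiseConstant (u ∘ stepTime d n) := by
  intro t ht
  obtain ⟨p, s, h0, hp, hlt, hF⟩ := exists_partition_of_finset ((Finset.range n).image d) ht
  refine ⟨p, s, h0, hp, hlt, fun k hk => ⟨u (stepTime d n ((s k + s (k + 1)) / 2)), fun r hr => ?_⟩⟩
  have h1 := hlt k hk
  refine congrArg u (stepTime_eq_of_forall_notMem (fun i hi => ?_) hr ⟨by linarith, by linarith⟩)
  exact hF k hk _ (Finset.mem_image_of_mem d (Finset.mem_range.2 hi))

theorem tendsto_stepTime {d : ℕ → ℝ} (hd : DenseRange d) {t : ℝ} (ht : 0 ≤ t) :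
    Tendsto (fun n => stepTime d n t) atTop (𝓝 t) := by
  rw [Metric.tendsto_atTop]
  intro ε hε
  obtain ⟨i, hi⟩ := hd.exists_mem_open isOpen_Ioo
    (nonempty_Ioo.2 (show t - ε < t by linarith))
  refine ⟨i + 1, fun n hn => ?_⟩
  have h1 := le_stepTime (show i < n by omega) hi.2.le
  have h2 := stepTime_le d n t
  rw [max_eq_left ht] at h2
  rw [Real.dist_eq, abs_lt]
  constructor <;> linarith [hi.1]

/-- Composing with a monotone map increases no variation and creates no new values. At a continuity
point `t > 0`, `stepTime d n t → t` suffices; a positive discontinuity is some `d i`, hence is hit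
exactly once `n > i`. -/
theorem exists_isApproximation {δ a T : ℝ} {u : ℝ → ℝ} (hu : u ∈ controlSet δ a) :
    ∃ v : ℕ → ℝ → ℝ, IsApproximation δ a T u v := by
  obtain ⟨hbv, hu0, huI⟩ := hu
  -- The rationals are added to make the enumerated set dense and nonempty.
  have hcount : ({x | ¬ ContinuousAt u x} ∪ range ((↑) : ℚ → ℝ)).Countable :=
    (countable_not_continuousAt_of_boundedVariationOn hbv).union (countable_range _)
  obtain ⟨d, hd⟩ := hcount.exists_eq_range ⟨_, Or.inr ⟨0, rfl⟩⟩
  have hdense : DenseRange d := by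
    rw [DenseRange, ← hd]
    exact (Rat.denseRange_cast (𝕜 := ℝ)).mono subset_union_right
  have hneg : ∀ n, ∀ t ≤ 0, stepTime d n t = 0 := fun n t ht =>
    le_antisymm ((stepTime_le d n t).trans_eq (max_eq_right ht)) (stepTime_nonneg d n t)
  refine ⟨fun n => u ∘ stepTime d n, fun n => ⟨?_, ?_, fun t => huI _⟩,
    fun n => isPiecewiseConstant_comp_stepTime u d n, fun t => ?_, fun n => ?_⟩
  · exact ne_top_of_le_ne_top hbv (eVariationOn.comp_le_of_monotoneOn u _
      ((stepTime_monotone d n).monotoneOn _) (mapsTo_univ _ _))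
  · intro t ht
    rw [Function.comp_apply, hneg n t ht, hu0 0 le_rfl]
  · simp only [Function.comp_apply]
    rcases le_or_gt t 0 with ht | ht
    · simp only [hneg _ t ht, hu0 0 le_rfl, hu0 t ht]
      exact tendsto_const_nhds
    · by_cases hc : ContinuousAt u t
      · exact hc.tendsto.comp (tendsto_stepTime hdense ht.le)
      · obtain ⟨i, hi⟩ : t ∈ range d := hd ▸ Or.inl hc
        refine tendsto_const_nhds.congr' ?_
        filter_upwards [eventually_gt_atTop i] with n hn
        have h1 := le_stepTime hn hi.le
        have h2 := stepTime_le d n t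
        rw [max_eq_left ht.le] at h2
        rw [le_antisymm h2 (hi ▸ h1)]
  · refine eVariationOn.comp_le_of_monotoneOn u _ ((stepTime_monotone d n).monotoneOn _) ?_
    intro t ht
    exact ⟨stepTime_nonneg d n t, (stepTime_le d n t).trans (max_le ht.2 (ht.1.trans ht.2))⟩

end StepApproximation

/-! ### Cauchy property and independence of the approximating sequence -/

section Convergence

variable {H : Type*} [NormedAddCommGroup H] [InnerProductSpace ℂ H] [CompleteSpace H]

theorem abs_mul_le_of_mem_controlSet {δ a : ℝ} (ha : 0 < a) {v : ℝ → ℝ} (hv : v ∈ controlSet δ a)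
    (r : ℝ) : |v r| * a ≤ 1 - δ :=
  (le_div_iff₀ ha).1 (abs_lt.2 (hv.2.2 r)).le

theorem intervalIntegrable_abs_sub {δ a : ℝ} {v w : ℝ → ℝ}
    (hv : v ∈ controlSet δ a) (hw : w ∈ controlSet δ a) (s t : ℝ) :
    IntervalIntegrable (fun r => |v r - w r|) MeasureTheory.volume s t := by
  have hm : Measurable fun r => |v r - w r| := by
    have h1 := measurable_of_boundedVariationOn hv.1
    have h2 := measurable_of_boundedVariationOn hw.1
    exact continuous_abs.measurable.comp (h1.sub h2)
  refine (intervalIntegrable_const (μ := MeasureTheory.volume) (c := 2 * ((1 - δ) / a))).mono_fun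
    hm.aestronglyMeasurable (Eventually.of_forall fun r => ?_)
  have h1 := abs_lt.2 (hv.2.2 r)
  have h2 := abs_lt.2 (hw.2.2 r)
  simp only [Real.norm_eq_abs, abs_abs]
  refine (abs_sub _ _).trans (le_trans ?_ (le_abs_self _))
  linarith

theorem IsApproximation.tendsto_integral {δ a T : ℝ} {u : ℝ → ℝ} {v : ℕ → ℝ → ℝ}
    (h : IsApproximation δ a T u v) (hu : u ∈ controlSet δ a) (t : ℝ) :
    Tendsto (fun n => ∫ r in (0 : ℝ)..t, |v n r - u r|) atTop (𝓝 0) := by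
  suffices h0 : Tendsto (fun n => ∫ r in (0 : ℝ)..t, |v n r - u r|) atTop
      (𝓝 (∫ _ in (0 : ℝ)..t, (0 : ℝ))) by
    rwa [intervalIntegral.integral_zero] at h0
  refine intervalIntegral.tendsto_integral_filter_of_dominated_convergence
    (fun _ => 2 * ((1 - δ) / a)) (Eventually.of_forall fun n => ?_)
    (Eventually.of_forall fun n => Eventually.of_forall fun r _ => ?_)
    intervalIntegrable_const (Eventually.of_forall fun r _ => ?_)
  · exact (intervalIntegrable_abs_sub (h.mem n) hu 0 t).aestronglyMeasurable_restrict_uIoc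
  · have h1 := abs_lt.2 ((h.mem n).2.2 r)
    have h2 := abs_lt.2 (hu.2.2 r)
    simp only [Real.norm_eq_abs, abs_abs]
    refine (abs_sub _ _).trans ?_
    linarith
  · simpa using ((h.tendsto r).sub_const (u r)).abs

theorem propagator_eq_concatenation (A B : H →ₗ.[ℂ] H) {v : ℝ → ℝ} (hv : IsPiecewiseConstant v)
    {t : ℝ} (ht : 0 ≤ t) : ∃ p s, IsSwitchingPartition v t p s ∧
      propagator A B v t = concatenation A B v s p := by
  have h : ∃ q : ℕ × (ℕ → ℝ), IsSwitchingPartition v t q.1 q.2 := by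
    obtain ⟨p, s, hps⟩ := hv t ht
    exact ⟨(p, s), hps⟩
  exact ⟨h.choose.1, h.choose.2, h.choose_spec, by rw [propagator, dif_pos h]⟩

namespace AdmissiblePair

variable {A B : H →ₗ.[ℂ] H} {a δ T : ℝ} (hAB : AdmissiblePair A B a 0)
include hAB

theorem norm_propagator_apply {v : ℝ → ℝ} (hv : ∀ r, |v r| * a < 1) (hpc : IsPiecewiseConstant v)
    {t : ℝ} (ht : 0 ≤ t) (x : H) : ‖propagator A B v t x‖ = ‖x‖ := by
  obtain ⟨p, s, -, h⟩ := propagator_eq_concatenation A B hpc ht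
  rw [h, concatenation_eq_expChain, hAB.norm_expChain_apply fun k => hv _]

/-- `C` depends on `u` and `ψ` but not on the sequences: taking `w = v` gives the Cauchy property,
while two sequences at equal indices give the same limit. -/
theorem exists_norm_propagator_sub_sq_le (ha : 0 < a) (hδ : δ ∈ Ioo (0 : ℝ) 1) {u : ℝ → ℝ}
    (hu : u ∈ controlSet δ a) {t : ℝ} (ht : t ∈ Icc 0 T) (ψ : A.domain) :
    ∃ C : ℝ, 0 ≤ C ∧ ∀ v w, IsApproximation δ a T u v → IsApproximation δ a T u w → ∀ m n,
      ‖propagator A B (v m) t ψ - propagator A B (w n) t ψ‖ ^ 2 ≤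
        C * ((∫ r in (0 : ℝ)..t, |v m r - u r|) + ∫ r in (0 : ℝ)..t, |w n r - u r|) := by
  set V := (eVariationOn u (Icc 0 T)).toReal
  have hV : eVariationOn u (Icc 0 T) = ENNReal.ofReal V :=
    (ENNReal.ofReal_toReal (hu.1.mono (subset_univ _))).symm
  have hV0 : 0 ≤ V := ENNReal.toReal_nonneg
  set M := a * (2 / δ * Real.exp (a / δ * V) * ‖A ψ‖)
  have hM : 0 ≤ M := by have := hδ.1; positivity
  have htraj : ∀ v, IsApproximation δ a T u v → ∀ n, ∃ x, IsTrajectory A B (v n) t ψ M x ∧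
      x t = propagator A B (v n) t ψ := by
    intro v hv n
    obtain ⟨p, s, hps, h⟩ := propagator_eq_concatenation A B (hv.piecewiseConstant n) ht.1
    rw [h]
    refine hAB.exists_isTrajectory hδ (abs_mul_le_of_mem_controlSet ha (hv.mem n)) hps hV0 ?_ ψ
    rw [← hV]
    exact (eVariationOn.mono _ (Icc_subset_Icc_right ht.2)).trans (hv.variation_le n)
  refine ⟨4 * ‖(ψ : H)‖ * M, by positivity, fun v w hv hw m n => ?_⟩
  obtain ⟨x, hx, hxt⟩ := htraj v hv m
  obtain ⟨y, hy, hyt⟩ := htraj w hw n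
  rw [← hxt, ← hyt]
  refine (hAB.norm_sub_sq_le_integral (fun r =>
    (abs_mul_le_of_mem_controlSet ha (hw.mem n) r).trans_lt (by linarith [hδ.1])) ht.1 hx hy
    (intervalIntegrable_abs_sub (hv.mem m) (hw.mem n) 0 t)).trans ?_
  refine mul_le_mul_of_nonneg_left ?_ (by positivity)
  have h1 := intervalIntegrable_abs_sub (hv.mem m) hu 0 t
  have h2 := intervalIntegrable_abs_sub (hw.mem n) hu 0 t
  rw [← intervalIntegral.integral_add h1 h2]
  refine intervalIntegral.integral_mono_on ht.1
    (intervalIntegrable_abs_sub (hv.mem m) (hw.mem n) 0 t) (h1.add h2) fun r _ => ?_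
  rw [abs_sub_comm (w n r)]
  exact abs_sub_le _ _ _

theorem cauchySeq_propagator (ha : 0 < a) (hδ : δ ∈ Ioo (0 : ℝ) 1) {u : ℝ → ℝ}
    (hu : u ∈ controlSet δ a) {v : ℕ → ℝ → ℝ} (hv : IsApproximation δ a T u v) {t : ℝ}
    (ht : t ∈ Icc 0 T) {ψ : H} (hψ : ψ ∈ A.domain) :
    CauchySeq fun n => propagator A B (v n) t ψ := by
  obtain ⟨C, hC, h⟩ := hAB.exists_norm_propagator_sub_sq_le ha hδ hu ht ⟨ψ, hψ⟩
  have h1 := (hv.tendsto_integral hu t).const_mul C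
  rw [mul_zero] at h1
  rw [Metric.cauchySeq_iff]
  intro ε hε
  obtain ⟨N, hN⟩ := eventually_atTop.1
    (h1.eventually (gt_mem_nhds (show 0 < ε ^ 2 / 2 by positivity)))
  refine ⟨N, fun m hm n hn => ?_⟩
  rw [dist_eq_norm]
  refine lt_of_pow_lt_pow_left₀ 2 hε.le ((h v v hv hv m n).trans_lt ?_)
  rw [mul_add]
  linarith [hN m hm, hN n hn]

theorem tendsto_propagator_sub (ha : 0 < a) (hδ : δ ∈ Ioo (0 : ℝ) 1) {u : ℝ → ℝ}
    (hu : u ∈ controlSet δ a) {v w : ℕ → ℝ → ℝ} (hv : IsApproximation δ a T u v)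
    (hw : IsApproximation δ a T u w) {t : ℝ} (ht : t ∈ Icc 0 T) {ψ : H} (hψ : ψ ∈ A.domain) :
    Tendsto (fun n => propagator A B (v n) t ψ - propagator A B (w n) t ψ) atTop (𝓝 0) := by
  obtain ⟨C, hC, h⟩ := hAB.exists_norm_propagator_sub_sq_le ha hδ hu ht ⟨ψ, hψ⟩
  have h1 := ((hv.tendsto_integral hu t).add (hw.tendsto_integral hu t)).const_mul C
  rw [add_zero, mul_zero] at h1
  have h2 := (squeeze_zero (fun n => sq_nonneg _) (fun n => h v w hv hw n n) h1).sqrt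
  rw [tendsto_zero_iff_norm_tendsto_zero]
  simpa [Real.sqrt_sq] using h2

end AdmissiblePair

end Convergence

end BilinearControl

theorem mainTheorem5 {H : Type*} [NormedAddCommGroup H] [InnerProductSpace ℂ H] [CompleteSpace H]
    [TopologicalSpace.SeparableSpace H]
    (A B : H →ₗ.[ℂ] H) (a δ T : ℝ) (ha : 0 < a) (hδ : δ ∈ Set.Ioo (0 : ℝ) 1)
    (hAB : BilinearControl.AdmissiblePair A B a 0)
    (u : ℝ → ℝ) (hu : u ∈ BilinearControl.controlSet δ a) :
    -- the unitary groups of which the propagators are made exist and are unique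
    (∀ c : ℝ, |c| < 1 / a → ∃! U : ℝ → H →L[ℂ] H,
      BilinearControl.IsUnitaryGroup U ∧ BilinearControl.IsGenerator (A + (c : ℂ) • B) U) ∧
    -- the Cauchy property
    (∀ v : ℕ → ℝ → ℝ, BilinearControl.IsApproximation δ a T u v →
      ∀ t ∈ Set.Icc 0 T, ∀ ψ ∈ A.domain,
        CauchySeq fun n => BilinearControl.propagator A B (v n) t ψ) ∧
    -- the propagator of `u` is well defined
    (∃ v : ℕ → ℝ → ℝ, BilinearControl.IsApproximation δ a T u v) ∧
    (∀ t ∈ Set.Icc 0 T, ∃! V : H →L[ℂ] H, ‖V‖ ≤ 1 ∧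
      ∀ v : ℕ → ℝ → ℝ, BilinearControl.IsApproximation δ a T u v →
        ∀ ψ ∈ A.domain,
          Tendsto (fun n => BilinearControl.propagator A B (v n) t ψ) atTop (𝓝 (V ψ))) := by
  open BilinearControl in
  refine ⟨fun c hc => hAB.existsUnique_unitaryGroup ((lt_div_iff₀ ha).1 hc),
    fun v hv t ht ψ hψ => hAB.cauchySeq_propagator ha hδ hu hv ht hψ,
    exists_isApproximation hu, fun t ht => ?_⟩
  obtain ⟨v, hv⟩ := BilinearControl.exists_isApproximation (T := T) hu
  have hdense := hAB.skewAdjoint.1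
  obtain ⟨W, hW, hlim⟩ := BilinearControl.exists_tendsto_of_cauchySeq_of_dense
    (V := fun n => BilinearControl.propagator A B (v n) t)
    (fun n x => (hAB.norm_propagator_apply (fun r =>
      (BilinearControl.abs_mul_le_of_mem_controlSet ha (hv.mem n) r).trans_lt
        (by linarith [hδ.1])) (hv.piecewiseConstant n) ht.1 x).le)
    hdense (fun ψ hψ => hAB.cauchySeq_propagator ha hδ hu hv ht hψ)
  refine ⟨W, ⟨hW, fun w hw ψ hψ => ?_⟩, fun W' hW' => ?_⟩
  · simpa using (hAB.tendsto_propagator_sub ha hδ hu hw hv ht hψ).add (hlim ψ)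
  -- The existing sequence `v` determines the operator on the dense subspace `D(A)`; without it the
  -- condition on `W'` could be vacuous.
  · refine ContinuousLinearMap.ext_on (hdense.mono Submodule.subset_span) fun ψ hψ => ?_
    exact tendsto_nhds_unique (hW'.2 v hv ψ hψ) (hlim ψ)
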